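/- Consider finite walks on the square lattice $\mathbb{Z}^2$ that start at $(0,0)$ and take unit steps north, east, south or west. A walk is \emph{self-avoiding} if it visits no node twice, and \emph{prudent} if it is self-avoiding and never takes a step towards an already occupied node, i.e. the lattice half-line issued from the current node in the direction of the next step contains no previously visited node. The \emph{box} of a walk is the smallest lattice rectangle that contains it. A prudent walk $\omega$ is \emph{3-sided} if each of its initial parts $\omega_i$ (the first $i$ steps, $0\le i\le |\omega|$) ends on the north, east or west side of the box of $\omega_i$, and if no step of $\omega$ leads from the south-east corner to the south-west corner of the current box, or vice versa, when that box (before the step) has width one and non-zero height. A \emph{3-sided prudent polygon} is a 3-sided prudent walk, not consisting of a single step, that ends at a node adjacent to its starting point; its \emph{area} is the area enclosed by the closed lattice polygon obtained by adding the edge from the endpoint to the starting point. Polygons are counted as walks, so different underlying walks are different polygons. Let $PA^{(3)}_n$ be the number of 3-sided prudent polygons of area $n$. Then $PA^{(3)}_n$ is finite for every $n$ (with $PA^{(3)}_0=0$), and the generating function $PA^{(3)}(q)=\sum_{n\ge 1}PA^{(3)}_n q^n$ is given, as an identity of formal power series in $q$, by $$PA^{(3)}(q) = \frac{-2q^3(1-q)^2}{(1-2q)^2}\sum_{m=1}^{\infty}\frac{(-1)^m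 q^{2m}}{(1-2q)^m(1-q-q^{m+1})} \prod_{k=1}^{m-1}\frac{1-q-q^k+q^{k+1}-q^{k+2}}{1-q-q^{k+1}}+\frac{2q(3-10q+9q^2-q^3)}{(1-2q)^2(1-q)},$$ where the sum over $m$ converges formally (each power of $q$ occurs in only finitely many summands). Its expansion begins $$PA^{(3)}(q)=6q+10q^2+20q^3+42q^4+92q^5+204q^6+454q^7+1010q^8+2242q^9+4962q^{10}+\cdots.$$ -/

import Mathlib

/-!
Up to reflection in the vertical axis, a 3-sided prudent polygon is either a single column, or a
sequence of columns hanging from the row `y = 1`, or a 3-sided walk in the half-plane `x ≤ 0` which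
is continued along its top row to the column `x = 1` and then goes down to `(1, 0)`. The walks in
the half-plane `x ≤ 0` are coded uniquely by words in which each letter is allowed or not according
to the box and the position reached so far. Removing the last letter of a code gives recursions for
the number of codes of given width and area, hence a functional equation relating their generating
function at `(q, u)` to the one at `(q, u q)`. Its iteration, starting from `u = 1`, produces the
sum over `m`.
-/

namespace Prudent

/-- The four unit steps on the square lattice. -/
inductive Dir where
  | north
  | east
  | south
  | west

/-- The displacement of a step. -/
def Dir.vec : Dir → ℤ × ℤ
  | .north => (0, 1)
  | .east => (1, 0)
  | .south => (0, -1)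
  | .west => (-1, 0)

/-- A finite nearest-neighbour walk on `ℤ × ℤ` started at the origin, given by its steps. -/
abbrev Walk := List Dir

namespace Walk

/-- The node reached after the first `i` steps (used for `i ≤ w.length`). -/
def pos (w : Walk) (i : ℕ) : ℤ × ℤ := ((w.take i).map Dir.vec).sum

/-- The walk visits no node twice. -/
def IsSelfAvoiding (w : Walk) : Prop :=
  ∀ i ≤ w.length, ∀ j ≤ w.length, w.pos i = w.pos j → i = j

/-- A self-avoiding walk that never takes a step towards an already occupied node: the lattice
half-line issued from the current node in the direction of the next step contains no node
visited so far. -/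
def IsPrudent (w : Walk) : Prop :=
  w.IsSelfAvoiding ∧
    ∀ (i : ℕ) (hi : i < w.length), ∀ j ≤ i, ∀ k : ℕ, 1 ≤ k → w.pos j ≠ w.pos i + k • (w[i]).vec

/-! The bounding box of the first `i` steps is `[xMin, xMax] × [yMin, yMax]`. -/

/-- Abscissa of the west side of the bounding box of the first `i` steps. -/
def xMin (w : Walk) (i : ℕ) : ℤ :=
  (Finset.range (i + 1)).inf' Finset.nonempty_range_add_one fun j => (w.pos j).1

/-- Abscissa of the east side of the bounding box of the first `i` steps. -/
def xMax (w : Walk) (i : ℕ) : ℤ :=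
  (Finset.range (i + 1)).sup' Finset.nonempty_range_add_one fun j => (w.pos j).1

/-- Ordinate of the south side of the bounding box of the first `i` steps. -/
def yMin (w : Walk) (i : ℕ) : ℤ :=
  (Finset.range (i + 1)).inf' Finset.nonempty_range_add_one fun j => (w.pos j).2

/-- Ordinate of the north side of the bounding box of the first `i` steps. -/
def yMax (w : Walk) (i : ℕ) : ℤ :=
  (Finset.range (i + 1)).sup' Finset.nonempty_range_add_one fun j => (w.pos j).2

/-- Step number `i` (from node `i` to node `i + 1`) joins the south-east corner of the current
bounding box to its south-west corner, or vice versa, the box having width one and non-zero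
height. -/
def CrossesSouthSide (w : Walk) (i : ℕ) : Prop :=
  w.xMax i - w.xMin i = 1 ∧ w.yMax i ≠ w.yMin i ∧
    ((w.pos i = (w.xMax i, w.yMin i) ∧ w.pos (i + 1) = (w.xMin i, w.yMin i)) ∨
      (w.pos i = (w.xMin i, w.yMin i) ∧ w.pos (i + 1) = (w.xMax i, w.yMin i)))

/-- A 3-sided prudent walk: every initial part ends on the north, east or west side of its
bounding box, and no step crosses the south side of a box of width one and non-zero height
(during such a step the walk, regarded as a continuous path, would be on the south side only). -/
def IsThreeSided (w : Walk) : Prop :=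
  w.IsPrudent ∧
    (∀ i ≤ w.length,
      (w.pos i).2 = w.yMax i ∨ (w.pos i).1 = w.xMax i ∨ (w.pos i).1 = w.xMin i) ∧
    ∀ i < w.length, ¬ w.CrossesSouthSide i

/-- A self-avoiding polygon: a self-avoiding walk, not of a single step, that ends at a node
adjacent to its starting point. -/
def IsPolygon (w : Walk) : Prop :=
  w.IsSelfAvoiding ∧ w.length ≠ 1 ∧ ∃ d : Dir, w.pos w.length = d.vec

/-- The area enclosed by the polygon which is obtained by closing the walk with the edge from its
endpoint back to the origin, i.e. `|∮ x dy|` along the closed lattice polygon. An edge from `a`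
to `b` contributes `a.1 * (b.2 - a.2)`, as `x` is constant on a vertical edge. -/
def area (w : Walk) : ℕ :=
  (∑ i ∈ Finset.range w.length, (w.pos i).1 * ((w.pos (i + 1)).2 - (w.pos i).2) +
    (w.pos w.length).1 * ((w.pos 0).2 - (w.pos w.length).2)).natAbs

end Walk

/-- The 3-sided prudent polygons of area `n`. -/
def threeSidedPolygons (n : ℕ) : Set Walk :=
  {w | w.IsPolygon ∧ w.IsThreeSided ∧ w.area = n}

open PowerSeries

/-- The area generating function of 3-sided prudent polygons. -/
noncomputable def PA3 : PowerSeries ℚ :=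
  PowerSeries.mk fun n => ((threeSidedPolygons n).ncard : ℚ)

/-- The summand of index `m ≥ 1`, as a formal power series in `q = X`. All series that are
inverted here have constant coefficient `1`. -/
noncomputable def summand (m : ℕ) : PowerSeries ℚ :=
  (-1) ^ m * X ^ (2 * m) * ((1 - 2 * X) ^ m * (1 - X - X ^ (m + 1)))⁻¹ *
    ∏ k ∈ Finset.Ico 1 m,
      (1 - X - X ^ k + X ^ (k + 1) - X ^ (k + 2)) * (1 - X - X ^ (k + 1))⁻¹

end Prudent

namespace Prudent

namespace Walk

variable {v w : Walk} {s : Dir} {z : ℤ × ℤ} {i k : ℕ}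

/-- The last node of a walk. -/
def endpoint (w : Walk) : ℤ × ℤ := (w.map Dir.vec).sum

/-- The set of nodes of a walk, described as the endpoints of its initial parts. -/
def visited (w : Walk) : Set (ℤ × ℤ) := endpoint '' {p | p <+: w}

@[simp] lemma endpoint_nil : endpoint [] = 0 := rfl

@[simp] lemma endpoint_append (v r : Walk) : endpoint (v ++ r) = endpoint v + endpoint r := by
  simp [endpoint]

@[simp] lemma endpoint_singleton (s : Dir) : endpoint [s] = s.vec := by
  simp [endpoint]

@[simp] lemma endpoint_replicate (k : ℕ) (s : Dir) :
    endpoint (List.replicate k s) = k • s.vec := by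
  simp [endpoint]

lemma pos_length (w : Walk) : w.pos w.length = endpoint w := by
  simp [pos, endpoint]

lemma pos_append_left (r : Walk) (h : i ≤ v.length) : pos (v ++ r) i = v.pos i := by
  simp [pos, List.take_append_of_le_length h]

lemma pos_succ (hi : i < w.length) : w.pos (i + 1) = w.pos i + (w[i]).vec := by
  unfold pos
  rw [List.take_succ_eq_append_getElem hi, List.map_append, List.sum_append]
  simp

lemma endpoint_mem_visited (w : Walk) : endpoint w ∈ visited w := ⟨w, List.prefix_rfl, rfl⟩

lemma zero_mem_visited (w : Walk) : 0 ∈ visited w := ⟨[], List.nil_prefix, rfl⟩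

lemma visited_mono (h : v <+: w) : visited v ⊆ visited w :=
  Set.image_mono fun _ hp => hp.trans h

lemma mem_visited_nil : z ∈ visited [] ↔ z = 0 := by
  simp [visited]

lemma mem_visited_concat :
    z ∈ visited (v ++ [s]) ↔ z ∈ visited v ∨ z = endpoint v + s.vec := by
  simp [visited, List.prefix_concat_iff, or_and_right, exists_or, or_comm, eq_comm]

lemma mem_visited_append_replicate :
    z ∈ visited (v ++ List.replicate k s) ↔
      z ∈ visited v ∨ ∃ j, 1 ≤ j ∧ j ≤ k ∧ z = endpoint v + j • s.vec := by
  induction k with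
  | zero => simp
  | succ k ih =>
    rw [List.replicate_succ', ← List.append_assoc, mem_visited_concat, ih, or_assoc,
      endpoint_append, endpoint_replicate, add_assoc, ← succ_nsmul]
    refine or_congr_right ⟨?_, ?_⟩
    · rintro (⟨j, h1, hj, hz⟩ | hz)
      · exact ⟨j, h1, hj.trans k.le_succ, hz⟩
      · exact ⟨k + 1, k.succ_pos, le_rfl, hz⟩
    · rintro ⟨j, h1, hj, hz⟩
      rcases Nat.le_succ_iff.1 hj with hj | rfl
      · exact Or.inl ⟨j, h1, hj, hz⟩
      · exact Or.inr hz

lemma mem_visited_take (hi : i ≤ w.length) : z ∈ visited (w.take i) ↔ ∃ j ≤ i, w.pos j = z := by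
  constructor
  · rintro ⟨p, hp, rfl⟩
    refine ⟨p.length, by simpa [hi] using hp.length_le, ?_⟩
    rw [pos, ← List.prefix_iff_eq_take.1 (hp.trans (List.take_prefix i w)), endpoint]
  · rintro ⟨j, hj, rfl⟩
    exact ⟨w.take j, List.take_prefix_take_left hj, rfl⟩

/-! ### The step-by-step description of 3-sided walks -/

/-- The half-line issued from the endpoint of `v` in the direction `s` is free of visited nodes. -/
def Free (v : Walk) : Dir → Prop
  | .north => ∀ z ∈ visited v, z.1 = (endpoint v).1 → z.2 ≤ (endpoint v).2
  | .south => ∀ z ∈ visited v, z.1 = (endpoint v).1 → (endpoint v).2 ≤ z.2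
  | .east => ∀ z ∈ visited v, z.2 = (endpoint v).2 → z.1 ≤ (endpoint v).1
  | .west => ∀ z ∈ visited v, z.2 = (endpoint v).2 → (endpoint v).1 ≤ z.1

lemma free_iff : Free v s ↔ ∀ z ∈ visited v, ∀ k : ℕ, 1 ≤ k → z ≠ endpoint v + k • s.vec := by
  constructor
  · intro h z hz k hk e
    obtain ⟨e1, e2⟩ := Prod.ext_iff.1 e
    cases s <;> have := h z hz <;> simp [Dir.vec] at e1 e2 <;> omega
  · intro h
    have key (k : ℤ) (hk : 1 ≤ k) (z) (hz : z ∈ visited v) : z ≠ endpoint v + k • s.vec := by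
      lift k to ℕ using by omega
      simpa using h z hz k (by omega)
    cases s <;> intro z hz e <;> by_contra hlt
    · exact key (z.2 - (endpoint v).2) (by omega) z hz (by ext <;> simp [Dir.vec, e])
    · exact key (z.1 - (endpoint v).1) (by omega) z hz (by ext <;> simp [Dir.vec, e])
    · exact key ((endpoint v).2 - z.2) (by omega) z hz (by ext <;> simp [Dir.vec, e])
    · exact key ((endpoint v).1 - z.1) (by omega) z hz (by ext <;> simp [Dir.vec, e])

/-- The node `e` lies on the north, east or west side of the bounding box of `S ∪ {e}`. -/
def OnSide (S : Set (ℤ × ℤ)) (e : ℤ × ℤ) : Prop :=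
  (∀ z ∈ S, z.2 ≤ e.2) ∨ (∀ z ∈ S, z.1 ≤ e.1) ∨ ∀ z ∈ S, e.1 ≤ z.1

/-- The unit step from `e` to `e'` joins the two ends of the south side of the bounding box of
`S`, which has width one and positive height. -/
def Crossing (S : Set (ℤ × ℤ)) (e e' : ℤ × ℤ) : Prop :=
  e'.1 ≠ e.1 ∧ (∃ z ∈ S, z.1 = e'.1) ∧ (∀ z ∈ S, z.1 = e.1 ∨ z.1 = e'.1) ∧
    (∀ z ∈ S, e.2 ≤ z.2) ∧ ∃ z ∈ S, e.2 < z.2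

/-- The 3-sided walk `v` may be continued by the step `s`. -/
structure Admissible (v : Walk) (s : Dir) : Prop where
  free : Free v s
  onSide : OnSide (visited v) (endpoint v + s.vec)
  not_crossing : ¬ Crossing (visited v) (endpoint v) (endpoint v + s.vec)

lemma isGreatest_sup'_range {α : Type*} [LinearOrder α] (f : ℕ → α) (i : ℕ) :
    IsGreatest (f '' Set.Iic i)
      ((Finset.range (i + 1)).sup' Finset.nonempty_range_add_one f) := by
  constructor
  · obtain ⟨j, hj, h⟩ := Finset.exists_mem_eq_sup' (Finset.nonempty_range_add_one (n := i)) f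
    exact ⟨j, Finset.mem_range_succ_iff.1 hj, h.symm⟩
  · rintro _ ⟨j, hj, rfl⟩
    exact Finset.le_sup' f (Finset.mem_range_succ_iff.2 hj)

lemma isLeast_inf'_range {α : Type*} [LinearOrder α] (f : ℕ → α) (i : ℕ) :
    IsLeast (f '' Set.Iic i) ((Finset.range (i + 1)).inf' Finset.nonempty_range_add_one f) :=
  isGreatest_sup'_range (α := αᵒᵈ) f i

lemma onSide_pos_iff (hi : i ≤ w.length) :
    ((w.pos i).2 = w.yMax i ∨ (w.pos i).1 = w.xMax i ∨ (w.pos i).1 = w.xMin i) ↔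
      OnSide (visited (w.take i)) (w.pos i) := by
  have eq_sup' (f : ℤ × ℤ → ℤ) : f (w.pos i) = (Finset.range (i + 1)).sup'
      Finset.nonempty_range_add_one (fun j => f (w.pos j)) ↔
        ∀ z ∈ visited (w.take i), f z ≤ f (w.pos i) := by
    have hmax := isGreatest_sup'_range (fun j => f (w.pos j)) i
    refine ⟨fun h z hz => ?_, fun h => ?_⟩
    · obtain ⟨j, hj, rfl⟩ := (mem_visited_take hi).1 hz
      exact h ▸ hmax.2 ⟨j, hj, rfl⟩
    · obtain ⟨j, hj, hj'⟩ := hmax.1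
      exact le_antisymm (hmax.2 ⟨i, Set.mem_Iic.2 le_rfl, rfl⟩)
        (hj'.symm.trans_le (h _ ((mem_visited_take hi).2 ⟨j, hj, rfl⟩)))
  have eq_inf' : (w.pos i).1 = w.xMin i ↔ ∀ z ∈ visited (w.take i), (w.pos i).1 ≤ z.1 := by
    have hmin := isLeast_inf'_range (fun j => (w.pos j).1) i
    refine ⟨fun h z hz => ?_, fun h => ?_⟩
    · obtain ⟨j, hj, rfl⟩ := (mem_visited_take hi).1 hz
      exact h ▸ hmin.2 ⟨j, hj, rfl⟩
    · obtain ⟨j, hj, hj'⟩ := hmin.1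
      exact le_antisymm ((h _ ((mem_visited_take hi).2 ⟨j, hj, rfl⟩)).trans_eq hj')
        (hmin.2 ⟨i, Set.mem_Iic.2 le_rfl, rfl⟩)
  exact or_congr (eq_sup' Prod.snd) (or_congr (eq_sup' Prod.fst) eq_inf')

lemma pos_succ_of_fst_ne (hi : i < w.length) (h : (w.pos (i + 1)).1 ≠ (w.pos i).1) :
    (w.pos (i + 1)).2 = (w.pos i).2 ∧
      ((w.pos (i + 1)).1 = (w.pos i).1 + 1 ∨ (w.pos (i + 1)).1 = (w.pos i).1 - 1) := by
  rw [pos_succ hi] at h ⊢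
  cases hs : w[i] <;> simp_all [Dir.vec, sub_eq_add_neg]

lemma crossesSouthSide_iff (hi : i < w.length) :
    w.CrossesSouthSide i ↔ Crossing (visited (w.take i)) (w.pos i) (w.pos (i + 1)) := by
  obtain ⟨⟨a, ha, hxMax⟩, le_xMax⟩ := isGreatest_sup'_range (fun j => (w.pos j).1) i
  obtain ⟨⟨b, hb, hxMin⟩, xMin_le⟩ := isLeast_inf'_range (fun j => (w.pos j).1) i
  obtain ⟨⟨c, hc, hyMax⟩, le_yMax⟩ := isGreatest_sup'_range (fun j => (w.pos j).2) i
  obtain ⟨⟨d, hd, hyMin⟩, yMin_le⟩ := isLeast_inf'_range (fun j => (w.pos j).2) i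
  simp only [mem_upperBounds, mem_lowerBounds, Set.forall_mem_image, Set.mem_Iic]
    at ha hb hc hd hxMax hxMin hyMax hyMin le_xMax xMin_le le_yMax yMin_le
  simp only [CrossesSouthSide, Crossing, mem_visited_take hi.le, forall_exists_index,
    and_imp, forall_apply_eq_imp_iff₂, exists_exists_and_eq_and]
  simp only [Prod.ext_iff, xMin, xMax, yMin, yMax]
  have pos_le_xMax := le_xMax le_rfl
  have xMin_le_pos := xMin_le le_rfl
  have yMin_le_pos := yMin_le le_rfl
  constructor
  · rintro ⟨hwidth, hheight, hends⟩
    refine ⟨by omega, ?_, fun j hj => ?_, fun j hj => ?_, c, hc, ?_⟩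
    · rcases hends with h | h
      exacts [⟨b, hb, by omega⟩, ⟨a, ha, by omega⟩]
    · have := le_xMax hj
      have := xMin_le hj
      omega
    · have := yMin_le hj
      omega
    · have := yMin_le hc
      omega
  · rintro ⟨hne, ⟨j, hj, hjx⟩, hcol, hsouth, l, hl, hly⟩
    have := pos_succ_of_fst_ne hi hne
    have := hcol a ha
    have := hcol b hb
    have := hsouth d hd
    have := le_xMax hj
    have := xMin_le hj
    have := le_yMax hl
    omega

/-- Self-avoidance comes for free: the last step onto a node visited before would be a step towards
an occupied node. -/
lemma isPrudent_iff : w.IsPrudent ↔ ∀ (i : ℕ) (hi : i < w.length), Free (w.take i) w[i] := by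
  have free_take (i : ℕ) (hi : i < w.length) : Free (w.take i) w[i] ↔
      ∀ j ≤ i, ∀ k : ℕ, 1 ≤ k → w.pos j ≠ w.pos i + k • (w[i]).vec := by
    simp only [free_iff, mem_visited_take hi.le, forall_exists_index, and_imp,
      forall_apply_eq_imp_iff₂]
    rfl
  refine ⟨fun h i hi => (free_take i hi).2 (h.2 i hi), fun h => ⟨?_, fun i hi =>
    (free_take i hi).1 (h i hi)⟩⟩
  have ne_of_lt {i j : ℕ} (hij : i < j) (hj : j ≤ w.length) : w.pos i ≠ w.pos j := by
    obtain ⟨j, rfl⟩ := Nat.exists_eq_add_of_lt hij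
    rw [pos_succ hj]
    simpa using (free_take _ hj).1 (h _ hj) i (Nat.le_add_right i j) 1 le_rfl
  intro i hi j hj e
  by_contra hne
  rcases lt_or_gt_of_ne hne with hlt | hlt
  exacts [ne_of_lt hlt hj e, ne_of_lt hlt hi e.symm]

lemma onSide_visited_concat (e : ℤ × ℤ) (he : e = endpoint v + s.vec) :
    OnSide (visited (v ++ [s])) e ↔ OnSide (visited v) e := by
  simp only [OnSide, mem_visited_concat, ← he, or_imp, forall_and, forall_eq, le_refl, and_true]

theorem isThreeSided_iff :
    w.IsThreeSided ↔ ∀ (i : ℕ) (hi : i < w.length), Admissible (w.take i) w[i] := by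
  have onSide_succ (i : ℕ) (hi : i < w.length) :
      ((w.pos (i + 1)).2 = w.yMax (i + 1) ∨ (w.pos (i + 1)).1 = w.xMax (i + 1) ∨
        (w.pos (i + 1)).1 = w.xMin (i + 1)) ↔
      OnSide (visited (w.take i)) (endpoint (w.take i) + (w[i]).vec) := by
    rw [onSide_pos_iff hi, List.take_succ_eq_append_getElem hi, pos_succ hi]
    exact onSide_visited_concat _ rfl
  have onSide_zero : (w.pos 0).2 = w.yMax 0 ∨ (w.pos 0).1 = w.xMax 0 ∨ (w.pos 0).1 = w.xMin 0 := by
    simp [yMax]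
  have crosses (i : ℕ) (hi : i < w.length) : w.CrossesSouthSide i ↔
      Crossing (visited (w.take i)) (endpoint (w.take i)) (endpoint (w.take i) + (w[i]).vec) := by
    rw [crossesSouthSide_iff hi, pos_succ hi]
    rfl
  rw [IsThreeSided, isPrudent_iff]
  constructor
  · rintro ⟨hfree, hside, hcross⟩ i hi
    exact ⟨hfree i hi, (onSide_succ i hi).1 (hside _ hi), (crosses i hi).not.1 (hcross i hi)⟩
  · refine fun h => ⟨fun i hi => (h i hi).free, fun i hi => ?_,
      fun i hi => (crosses i hi).not.2 (h i hi).not_crossing⟩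
    cases i with
    | zero => exact onSide_zero
    | succ i => exact (onSide_succ i hi).2 (h i hi).onSide

lemma isThreeSided_nil : IsThreeSided [] :=
  isThreeSided_iff.2 fun i hi => absurd hi i.not_lt_zero

lemma isThreeSided_concat : IsThreeSided (v ++ [s]) ↔ IsThreeSided v ∧ Admissible v s := by
  simp only [isThreeSided_iff, List.length_append, List.length_singleton]
  constructor
  · refine fun h => ⟨fun i hi => ?_, by simpa using h v.length (Nat.lt_succ_self _)⟩
    simpa [List.take_append_of_le_length hi.le, List.getElem_append_left hi]
      using h i (Nat.lt_succ_of_lt hi)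
  · rintro ⟨h, hs⟩ i hi
    rcases Nat.lt_succ_iff_lt_or_eq.1 hi with hi | rfl
    · simpa [List.take_append_of_le_length hi.le, List.getElem_append_left hi] using h i hi
    · simpa using hs

namespace IsThreeSided

lemma of_prefix (h : IsThreeSided w) (hv : v <+: w) : IsThreeSided v := by
  obtain ⟨r, rfl⟩ := hv
  induction r using List.reverseRecOn with
  | nil => simpa using h
  | append_singleton r s ih =>
    rw [← List.append_assoc, isThreeSided_concat] at h
    exact ih h.1

lemma onSide (h : IsThreeSided w) : OnSide (visited w) (endpoint w) := by
  have := (onSide_pos_iff le_rfl).1 (h.2.1 w.length le_rfl)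
  rwa [List.take_length, pos_length] at this

lemma admissible (h : IsThreeSided w) (hv : v ++ [s] <+: w) : Admissible v s :=
  (isThreeSided_concat.1 (h.of_prefix hv)).2

end IsThreeSided

lemma Admissible.notMem_visited (h : Admissible v s) : endpoint v + s.vec ∉ visited v := fun hm =>
  free_iff.1 h.free _ hm 1 le_rfl (by simp)

end Walk

/-! ### Reflection in the vertical axis -/

/-- Reflection of a step in the vertical axis. -/
def Dir.mirror : Dir → Dir
  | .north => .north
  | .east => .west
  | .south => .south
  | .west => .east

lemma Dir.vec_mirror (s : Dir) : s.mirror.vec = (-s.vec.1, s.vec.2) := by cases s <;> rfl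

lemma Dir.mirror_mirror (s : Dir) : s.mirror.mirror = s := by cases s <;> rfl

lemma ordConnected_insert {S : Set ℤ} (hS : S.OrdConnected) {x y : ℤ} (hx : x ∈ S)
    (hxy : |y - x| ≤ 1) : (insert y S).OrdConnected := by
  rw [abs_le] at hxy
  refine ⟨fun a ha b hb c ⟨hac, hcb⟩ => or_iff_not_imp_left.2 fun hcy => ?_⟩
  rcases ha with rfl | ha <;> rcases hb with rfl | hb
  · exact absurd (le_antisymm hcb hac) hcy
  · exact hS.out hx hb ⟨by omega, hcb⟩
  · exact hS.out ha hx ⟨hac, by omega⟩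
  · exact hS.out ha hb ⟨hac, hcb⟩

namespace Walk

variable {u v w : Walk} {s : Dir} {z : ℤ × ℤ} {i k : ℕ}

/-- Reflection of a walk in the vertical axis. -/
def mirror (v : Walk) : Walk := v.map Dir.mirror

lemma mirror_mirror (v : Walk) : mirror (mirror v) = v := by
  simp [mirror, Function.comp_def, Dir.mirror_mirror]

lemma mirror_injective : Function.Injective mirror :=
  Function.LeftInverse.injective mirror_mirror

@[simp] lemma length_mirror (v : Walk) : (mirror v).length = v.length := by simp [mirror]

lemma mirror_concat (v : Walk) (s : Dir) : mirror (v ++ [s]) = mirror v ++ [s.mirror] := by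
  simp [mirror]

lemma endpoint_mirror (v : Walk) : endpoint (mirror v) = (-(endpoint v).1, (endpoint v).2) := by
  induction v using List.reverseRecOn with
  | nil => rfl
  | append_singleton v s ih =>
    rw [mirror_concat, endpoint_append, endpoint_append, ih]
    ext <;> simp [Dir.vec_mirror, add_comm]

lemma pos_mirror (v : Walk) (i : ℕ) : pos (mirror v) i = (-(pos v i).1, (pos v i).2) := by
  have : pos (mirror v) i = endpoint (mirror (v.take i)) := by
    simp [pos, endpoint, mirror, List.map_take]
  rw [this, endpoint_mirror]
  rfl

lemma visited_mirror (v : Walk) : visited (mirror v) = (fun z => (-z.1, z.2)) '' visited v := by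
  apply Set.Subset.antisymm
  · rintro _ ⟨p, hp, rfl⟩
    exact ⟨endpoint (mirror p), ⟨mirror p, mirror_mirror v ▸ hp.map Dir.mirror, rfl⟩,
      by simp [endpoint_mirror]⟩
  · rintro _ ⟨_, ⟨p, hp, rfl⟩, rfl⟩
    exact ⟨mirror p, hp.map Dir.mirror, endpoint_mirror p⟩

lemma Free.mirror (h : Free v s) : Free (mirror v) s.mirror := by
  cases s <;>
    simpa only [Free, Dir.mirror, visited_mirror, endpoint_mirror, Set.forall_mem_image, neg_inj,
      neg_le_neg_iff] using h

lemma Admissible.mirror (h : Admissible v s) : Admissible (mirror v) s.mirror := by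
  have hstep : endpoint (Walk.mirror v) + s.mirror.vec =
      (-(endpoint v + s.vec).1, (endpoint v + s.vec).2) := by
    ext <;> simp [endpoint_mirror, Dir.vec_mirror, add_comm]
  refine ⟨h.free.mirror, ?_, fun hc => h.not_crossing ?_⟩
  · have := h.onSide
    simp only [OnSide, hstep, visited_mirror, Set.forall_mem_image, neg_le_neg_iff] at this ⊢
    tauto
  · rw [hstep, endpoint_mirror] at hc
    simpa only [Crossing, visited_mirror, Set.forall_mem_image, Set.exists_mem_image, neg_inj,
      ne_eq] using hc

lemma IsThreeSided.mirror (h : IsThreeSided v) : IsThreeSided (mirror v) := by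
  induction v using List.reverseRecOn with
  | nil => exact h
  | append_singleton v s ih =>
    rw [isThreeSided_concat] at h
    rw [mirror_concat, isThreeSided_concat]
    exact ⟨ih h.1, h.2.mirror⟩

lemma area_mirror (v : Walk) : area (mirror v) = area v := by
  unfold area
  rw [← Int.natAbs_neg]
  simp only [length_mirror, pos_mirror, neg_add, ← Finset.sum_neg_distrib, neg_mul, neg_neg]

/-! ### Continuing a 3-sided walk -/

lemma ordConnected_image_visited (φ : ℤ × ℤ →+ ℤ) (hφ : ∀ s : Dir, |φ s.vec| ≤ 1) (u : Walk) :
    (φ '' visited u).OrdConnected := by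
  induction u using List.reverseRecOn with
  | nil =>
    have : φ '' visited [] = {0} := by
      ext
      simp [mem_visited_nil, eq_comm]
    exact this ▸ Set.ordConnected_singleton
  | append_singleton u s ih =>
    have : visited (u ++ [s]) = insert (endpoint u + s.vec) (visited u) := by
      ext
      simp only [mem_visited_concat, Set.mem_insert_iff, or_comm]
    rw [this, Set.image_insert_eq]
    exact ordConnected_insert ih ⟨_, endpoint_mem_visited u, rfl⟩ (by simpa using hφ s)

lemma exists_mem_visited_fst_eq {a b : ℤ × ℤ} {x : ℤ} (ha : a ∈ visited u) (hb : b ∈ visited u)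
    (hax : a.1 ≤ x) (hxb : x ≤ b.1) : ∃ z ∈ visited u, z.1 = x :=
  (ordConnected_image_visited (.fst ℤ ℤ) (fun s => by cases s <;> decide) u).out
    ⟨a, ha, rfl⟩ ⟨b, hb, rfl⟩ ⟨hax, hxb⟩

lemma exists_mem_visited_snd_eq {a b : ℤ × ℤ} {y : ℤ} (ha : a ∈ visited u) (hb : b ∈ visited u)
    (hay : a.2 ≤ y) (hyb : y ≤ b.2) : ∃ z ∈ visited u, z.2 = y :=
  (ordConnected_image_visited (.snd ℤ ℤ) (fun s => by cases s <;> decide) u).out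
    ⟨a, ha, rfl⟩ ⟨b, hb, rfl⟩ ⟨hay, hyb⟩

/-- Otherwise the endpoint would be the south end of a column of a box of width one (the step would
cross the south side) or the row of the endpoint would have been visited before. -/
lemma Admissible.exists_mem_visited_third_column (h3 : IsThreeSided v) (h : Admissible v s)
    (hs : s.vec.2 = 0) (hs' : s.vec.1 ≠ 0) {z z' : ℤ × ℤ} (hz : z ∈ visited v)
    (hlt : (endpoint v).2 < z.2) (hz' : z' ∈ visited v) (hz1 : z'.1 = (endpoint v + s.vec).1) :
    ∃ x ∈ visited v, x.1 ≠ (endpoint v).1 ∧ x.1 ≠ (endpoint v + s.vec).1 := by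
  by_contra! hcol
  replace hcol : ∀ x ∈ visited v, x.1 = (endpoint v).1 ∨ x.1 = (endpoint v + s.vec).1 :=
    fun x hx => or_iff_not_imp_left.2 (hcol x hx)
  obtain ⟨x, hx, hx2⟩ : ∃ x ∈ visited v, x.2 < (endpoint v).2 := by
    by_contra! hsouth
    exact h.not_crossing ⟨by simpa using hs', ⟨z', hz', hz1⟩, hcol, hsouth, z, hz, hlt⟩
  rcases List.eq_nil_or_concat' v with rfl | ⟨u, t, rfl⟩
  · rw [mem_visited_nil] at hx hz
    subst hx hz
    exact lt_irrefl _ hx2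
  have mem_visited_init {y : ℤ × ℤ} (hy : y ∈ visited (u ++ [t]))
      (hne : y.2 ≠ (endpoint (u ++ [t])).2) : y ∈ visited u := by
    refine (mem_visited_concat.1 hy).resolve_right fun e => hne ?_
    rw [e, endpoint_append, endpoint_singleton]
  obtain ⟨r, hr, hr2⟩ := exists_mem_visited_snd_eq (mem_visited_init hx hx2.ne)
    (mem_visited_init hz hlt.ne') hx2.le hlt.le
  have hrv := visited_mono (List.prefix_append u [t]) hr
  rcases hcol r hrv with e | e
  · refine (isThreeSided_concat.1 h3).2.notMem_visited ?_
    have : r = endpoint (u ++ [t]) := Prod.ext e hr2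
    rwa [this, endpoint_append, endpoint_singleton] at hr
  · refine h.notMem_visited ?_
    have : r = endpoint (u ++ [t]) + s.vec := Prod.ext e (by simpa [hs] using hr2)
    rwa [this] at hrv

lemma Admissible.east_extends (h3 : IsThreeSided v) (h : Admissible v .east) (hz : z ∈ visited v)
    (hlt : (endpoint v).2 < z.2) : ∀ x ∈ visited v, x.1 ≤ (endpoint v).1 := by
  by_contra! ⟨x, hx, hxe⟩
  have hwest : ∀ y ∈ visited v, (endpoint v).1 ≤ y.1 := by
    rcases h3.onSide with k | k | k
    · exact absurd (k z hz) hlt.not_ge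
    · exact absurd (k x hx) hxe.not_ge
    · exact k
  have heast : ∀ y ∈ visited v, y.1 ≤ (endpoint v).1 + 1 := by
    rcases h.onSide with k | k | k
    · exact absurd (k z hz) (by simpa [Dir.vec] using hlt)
    · exact k
    · exact absurd (k _ (endpoint_mem_visited v)) (by simp [Dir.vec])
  obtain ⟨y, hy, hy1, hy2⟩ := h.exists_mem_visited_third_column h3 rfl one_ne_zero hz hlt hx
    (le_antisymm (heast x hx) hxe)
  exact hy2 (le_antisymm (heast y hy) (lt_of_le_of_ne (hwest y hy) hy1.symm))

lemma Admissible.west_extends (h3 : IsThreeSided v) (h : Admissible v .west) (hz : z ∈ visited v)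
    (hlt : (endpoint v).2 < z.2) : ∀ x ∈ visited v, (endpoint v).1 ≤ x.1 := by
  have := h.mirror.east_extends h3.mirror (z := (-z.1, z.2)) (visited_mirror v ▸ ⟨z, hz, rfl⟩)
    (by simpa [endpoint_mirror] using hlt)
  simpa only [visited_mirror, endpoint_mirror, Set.forall_mem_image, neg_le_neg_iff] using this

lemma Admissible.of_vertical (hs : s.vec.1 = 0) (hf : Free v s)
    (hside : (∀ z ∈ visited v, (endpoint v).1 ≤ z.1) ∨ ∀ z ∈ visited v, z.1 ≤ (endpoint v).1) :
    Admissible v s :=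
  ⟨hf, Or.inr (by simpa [hs] using hside.symm), fun hc => hc.1 (by simp [hs])⟩

lemma Admissible.of_horizontal (hs : s.vec.2 = 0) (hf : Free v s)
    (hside : ∀ z ∈ visited v, z.2 ≤ (endpoint v).2) : Admissible v s :=
  ⟨hf, Or.inl (by simpa [hs] using hside), fun ⟨_, _, _, _, z, hz, hlt⟩ => (hside z hz).not_gt hlt⟩

lemma Free.append_replicate (hf : Free v s) (k : ℕ) : Free (v ++ List.replicate k s) s := by
  rw [free_iff] at hf ⊢
  intro z hz j hj
  rw [endpoint_append, endpoint_replicate, add_assoc, ← add_smul]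
  rcases mem_visited_append_replicate.1 hz with hz | ⟨i, -, hik, rfl⟩
  · exact hf z hz _ (by omega)
  · intro e
    obtain ⟨e1, e2⟩ := Prod.ext_iff.1 e
    cases s <;> simp [Dir.vec] at e1 e2 <;> omega

lemma IsThreeSided.append_replicate (h3 : IsThreeSided v)
    (h : ∀ j < k, Admissible (v ++ List.replicate j s) s) :
    IsThreeSided (v ++ List.replicate k s) := by
  induction k with
  | zero => simpa using h3
  | succ k ih =>
    rw [List.replicate_succ', ← List.append_assoc, isThreeSided_concat]
    exact ⟨ih fun j hj => h j (hj.trans k.lt_succ_self), h k k.lt_succ_self⟩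

lemma IsThreeSided.append_replicate_vertical (h3 : IsThreeSided v) (hs : s.vec.1 = 0)
    (hf : Free v s)
    (hside : (∀ z ∈ visited v, (endpoint v).1 ≤ z.1) ∨ ∀ z ∈ visited v, z.1 ≤ (endpoint v).1)
    (k : ℕ) : IsThreeSided (v ++ List.replicate k s) := by
  refine h3.append_replicate fun j _ => .of_vertical hs (hf.append_replicate j) ?_
  refine hside.imp ?_ ?_ <;>
  · intro h z hz
    rcases mem_visited_append_replicate.1 hz with hz | ⟨i, -, -, rfl⟩
    · simpa [hs] using h z hz
    · simp [hs]

lemma IsThreeSided.append_replicate_horizontal (h3 : IsThreeSided v) (hs : s.vec.2 = 0)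
    (hf : Free v s) (hside : ∀ z ∈ visited v, z.2 ≤ (endpoint v).2) (k : ℕ) :
    IsThreeSided (v ++ List.replicate k s) := by
  refine h3.append_replicate fun j _ => .of_horizontal hs (hf.append_replicate j) fun z hz => ?_
  rcases mem_visited_append_replicate.1 hz with hz | ⟨i, -, -, rfl⟩
  · simpa [hs] using hside z hz
  · simp [hs]

lemma IsThreeSided.concat_east (h3 : IsThreeSided v)
    (hside : ∀ z ∈ visited v, z.1 ≤ (endpoint v).1) : IsThreeSided (v ++ [.east]) := by
  have hlt : ∀ z ∈ visited v, z.1 < (endpoint v + Dir.east.vec).1 := fun z hz =>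
    Int.lt_add_one_iff.2 (hside z hz)
  exact isThreeSided_concat.2 ⟨h3, fun z hz _ => hside z hz,
    Or.inr (Or.inl fun z hz => (hlt z hz).le),
    fun ⟨_, ⟨z, hz, hz1⟩, _⟩ => (hlt z hz).ne hz1⟩

lemma IsThreeSided.concat_west (h3 : IsThreeSided v)
    (hside : ∀ z ∈ visited v, (endpoint v).1 ≤ z.1) : IsThreeSided (v ++ [.west]) := by
  have := (h3.mirror.concat_east (by
    simpa only [visited_mirror, endpoint_mirror, Set.forall_mem_image, neg_le_neg_iff]
      using hside)).mirror
  rwa [mirror_concat, mirror_mirror] at this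

lemma IsThreeSided.concat_north (h3 : IsThreeSided v)
    (hside : ∀ z ∈ visited v, z.2 ≤ (endpoint v).2) : IsThreeSided (v ++ [.north]) :=
  isThreeSided_concat.2 ⟨h3, fun z hz _ => hside z hz,
    Or.inl fun z hz => (Int.lt_add_one_iff.2 (hside z hz)).le, fun h => h.1 (add_zero _)⟩

/-! ### Signed area -/

/-- The integral of `x dy` along a walk. -/
def signedArea (v : Walk) : ℤ :=
  ∑ i ∈ Finset.range v.length, (v.pos i).1 * ((v.pos (i + 1)).2 - (v.pos i).2)

@[simp] lemma signedArea_nil : signedArea [] = 0 := rfl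

lemma signedArea_concat (v : Walk) (s : Dir) :
    signedArea (v ++ [s]) = signedArea v + (endpoint v).1 * s.vec.2 := by
  have hlen : (v ++ [s]).length = v.length + 1 := by simp
  rw [signedArea, hlen, Finset.sum_range_succ]
  congr 1
  · refine Finset.sum_congr rfl fun i hi => ?_
    rw [Finset.mem_range] at hi
    rw [pos_append_left _ hi.le, pos_append_left _ hi]
  · rw [pos_append_left _ le_rfl, ← hlen, pos_length, pos_length, endpoint_append]
    simp

lemma signedArea_append_replicate (v : Walk) (k : ℕ) (s : Dir) :
    signedArea (v ++ List.replicate k s) = signedArea v + k * ((endpoint v).1 * s.vec.2) := by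
  induction k with
  | zero => simp
  | succ k ih =>
    rw [List.replicate_succ', ← List.append_assoc, signedArea_concat, ih]
    have : s.vec.1 * s.vec.2 = 0 := by cases s <;> rfl
    rw [endpoint_append, endpoint_replicate, Prod.fst_add, Prod.smul_fst, nsmul_eq_mul]
    push_cast
    linear_combination (k : ℤ) * this

lemma area_eq {d : Dir} (h : endpoint w = d.vec) : w.area = (signedArea w).natAbs := by
  unfold area signedArea
  rw [pos_length, h]
  cases d <;> simp [Dir.vec, pos]

end Walk

open Walk

section Codes

/-! ### Codes of 3-sided walks in the half-plane `x ≤ 0` -/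

/-- The letters of a code; see `block` for the steps which they stand for. -/
inductive Letter where
  | dig (d : ℕ)
  | rise
  | shift (p : ℕ)
  | extend

/-- Positions of a 3-sided walk in the half-plane `x ≤ 0`, with box `[-w, 0] × [_, t]`.
In `column w d t` the walk has just reached the column `x = -w`, at distance `d` below the top row;
in `row w p t` it has just reached the row `y = t`, at abscissa `-p`. -/
inductive State where
  | column (w d t : ℕ)
  | row (w p t : ℕ)

/-- The letters that may be read in a given state. -/
def Allowed : State → Letter → Prop
  | .column _ _ _, .dig _ => True
  | .column _ _ _, .rise => True
  | .row w _ _, .shift p' => p' ≤ w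
  | .row _ _ _, .extend => True
  | _, _ => False

/-- The vertical run from depth `d` to depth `d'`. -/
def vert (d d' : ℕ) : Walk := List.replicate (d' - d) .south ++ List.replicate (d - d') .north

/-- The horizontal run from abscissa `-p` to abscissa `-p'`. -/
def horiz (p p' : ℕ) : Walk := List.replicate (p' - p) .west ++ List.replicate (p - p') .east

/-- The steps that a letter stands for. -/
def block : State → Letter → Walk
  | .column _ d _, .dig d' => vert d d' ++ [.west]
  | .column _ d _, .rise => vert (d + 1) 0
  | .row _ p _, .shift p' => horiz p p' ++ [.north]
  | .row w p _, .extend => horiz p (w + 1)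
  | _, _ => []

/-- The state after reading a letter. -/
def next : State → Letter → State
  | .column w _ t, .dig d' => .column (w + 1) d' t
  | .column w _ t, .rise => .row w w (t + 1)
  | .row w _ t, .shift p' => .row w p' (t + 1)
  | .row w _ t, .extend => .column (w + 1) 0 t
  | st, _ => st

/-- The area that a letter contributes. -/
def letterWeight : State → Letter → ℕ
  | .column _ _ _, .dig d' => d'
  | .column w _ _, .rise => w + 1
  | .row _ _ _, .shift p' => p' + 1
  | _, _ => 0

/-! A code is a list of letters, the last letter coming first. -/

/-- The state reached by a code. -/
def state : List Letter → State
  | [] => .column 0 0 0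
  | a :: c => next (state c) a

/-- The walk of a code. -/
def word : List Letter → Walk
  | [] => []
  | a :: c => word c ++ block (state c) a

/-- Each letter of the code is allowed. -/
def Valid : List Letter → Prop
  | [] => True
  | a :: c => Valid c ∧ Allowed (state c) a

/-- The area of a code. -/
def weight : List Letter → ℕ
  | [] => 0
  | a :: c => weight c + letterWeight (state c) a

variable {c c' l : List Letter} {a b : Letter} {st : State} {v r r' : Walk} {z : ℤ × ℤ}
  {w d d' p p' t : ℕ}

lemma endpoint_vert (d d' : ℕ) : endpoint (vert d d') = (0, (d : ℤ) - d') := by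
  ext <;> simp [vert, Dir.vec]
  omega

lemma endpoint_horiz (p p' : ℕ) : endpoint (horiz p p') = ((p : ℤ) - p', 0) := by
  ext <;> simp [horiz, Dir.vec]
  omega

lemma vert_of_le (h : d ≤ d') : vert d d' = List.replicate (d' - d) .south := by
  simp [vert, Nat.sub_eq_zero_of_le h]

lemma vert_of_ge (h : d' ≤ d) : vert d d' = List.replicate (d - d') .north := by
  simp [vert, Nat.sub_eq_zero_of_le h]

lemma horiz_of_le (h : p ≤ p') : horiz p p' = List.replicate (p' - p) .west := by
  simp [horiz, Nat.sub_eq_zero_of_le h]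

lemma horiz_of_ge (h : p' ≤ p) : horiz p p' = List.replicate (p - p') .east := by
  simp [horiz, Nat.sub_eq_zero_of_le h]

/-! ### Unique decodability -/

/-- In a state `row w p t` that occurs, `p ≤ w`. -/
def Proper : State → Prop
  | .column _ _ _ => True
  | .row w p _ => p ≤ w

lemma Proper.next (h : Proper st) (ha : Allowed st a) : Proper (next st a) := by
  cases st <;> cases a <;> first | trivial | exact le_rfl

lemma Valid.proper (hc : Valid c) : Proper (state c) := by
  induction c with
  | nil => trivial
  | cons a c ih => exact (ih hc.1).next hc.2

lemma Valid.of_append (h : Valid (l ++ c)) : Valid c := by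
  induction l with
  | nil => exact h
  | cons a l ih => exact ih h.1

lemma prefix_of_append_cons_eq {α : Type*} {u u' r r' : List α} {y : α} (hy : y ∉ u')
    (h : u ++ y :: r = u' ++ r') : u' <+: u := by
  rcases List.append_eq_append_iff.1 h with ⟨m, rfl, hm⟩ | ⟨m, rfl, -⟩
  · cases m with
    | nil => simp
    | cons x m =>
      obtain ⟨rfl, -⟩ := List.cons_eq_cons.1 hm
      simp at hy
  · exact List.prefix_append u' m

lemma append_cons_inj {α : Type*} {u u' r r' : List α} {y : α} (hu : y ∉ u) (hu' : y ∉ u')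
    (h : u ++ y :: r = u' ++ y :: r') : u = u' ∧ r = r' := by
  obtain rfl := (prefix_of_append_cons_eq hu h.symm).eq_of_length_le
    (prefix_of_append_cons_eq hu' h).length_le
  exact ⟨rfl, List.cons_injective (List.append_cancel_left h)⟩

lemma vert_append_west_inj (h : (vert d d' ++ [.west]) ++ r = (vert d p ++ [.west]) ++ r') :
    d' = p ∧ r = r' := by
  have west_notMem (m n : ℕ) : Dir.west ∉ vert m n := by simp [vert]
  simp only [List.append_assoc, List.singleton_append] at h
  obtain ⟨hvert, hr⟩ := append_cons_inj (west_notMem d d') (west_notMem d p) h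
  have := congrArg endpoint hvert
  simp only [endpoint_vert, Prod.mk.injEq] at this
  exact ⟨by omega, hr⟩

lemma horiz_append_north_inj (h : (horiz p p' ++ [.north]) ++ r = (horiz p d ++ [.north]) ++ r') :
    p' = d ∧ r = r' := by
  have north_notMem (m n : ℕ) : Dir.north ∉ horiz m n := by simp [horiz]
  simp only [List.append_assoc, List.singleton_append] at h
  obtain ⟨hhoriz, hr⟩ := append_cons_inj (north_notMem p p') (north_notMem p d) h
  have := congrArg endpoint hhoriz
  simp only [endpoint_horiz, Prod.mk.injEq] at this
  exact ⟨by omega, hr⟩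

lemma block_dig_append_ne_block_rise_append :
    block (.column w d t) (.dig d') ++ r ≠ block (.column w d t) .rise ++ r' := by
  intro h
  simp only [block, List.append_assoc, List.singleton_append] at h
  have hpre := prefix_of_append_cons_eq (by simp [vert]) h
  classical
  have : d + 1 ≤ d - d' := by
    simpa [vert, List.count_replicate] using hpre.sublist.count_le Dir.north
  omega

lemma block_shift_append_ne_block_extend_append (hp : p ≤ w) (hp' : p' ≤ w) :
    block (.row w p t) (.shift p') ++ r ≠ block (.row w p t) .extend ++ r' := by
  intro h
  simp only [block, List.append_assoc, List.singleton_append] at h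
  have hpre := prefix_of_append_cons_eq (by simp [horiz]) h
  classical
  have : w + 1 - p ≤ p' - p := by
    simpa [horiz, List.count_replicate] using hpre.sublist.count_le Dir.west
  omega

lemma block_prefix_free (hst : Proper st) (ha : Allowed st a) (hb : Allowed st b)
    (h : block st a ++ r = block st b ++ r') : a = b ∧ r = r' := by
  cases st <;> cases a <;> cases b <;> simp only [Allowed] at ha hb
  · obtain ⟨rfl, hr⟩ := vert_append_west_inj h
    exact ⟨rfl, hr⟩
  · exact absurd h block_dig_append_ne_block_rise_append
  · exact absurd h.symm block_dig_append_ne_block_rise_append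
  · exact ⟨rfl, List.append_cancel_left h⟩
  · obtain ⟨rfl, hr⟩ := horiz_append_north_inj h
    exact ⟨rfl, hr⟩
  · exact absurd h (block_shift_append_ne_block_extend_append hst ha)
  · exact absurd h.symm (block_shift_append_ne_block_extend_append hst hb)
  · exact ⟨rfl, List.append_cancel_left h⟩

lemma block_ne_nil (hst : Proper st) (ha : Allowed st a) : block st a ≠ [] := by
  cases st <;> cases a <;> simp only [Allowed] at ha
  · simp [block]
  · simp [block, vert]
  · simp [block]
  · have := Nat.sub_ne_zero_of_lt (Nat.lt_succ_of_le hst)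
    simp [block, horiz, this]

lemma word_append_prefix (l c : List Letter) : word c <+: word (l ++ c) := by
  induction l with
  | nil => exact List.prefix_rfl
  | cons a l ih => exact ih.trans (List.prefix_append _ _)

lemma suffix_or_suffix_of_word_append_eq (hc : Valid c) (hc' : Valid c')
    (h : word c ++ r = word c' ++ r') : c <:+ c' ∨ c' <:+ c := by
  induction c generalizing r with
  | nil => exact Or.inl (List.nil_suffix)
  | cons a c ih =>
    rw [word, List.append_assoc] at h
    rcases ih hc.1 h with ⟨l, rfl⟩ | hsuf
    · rcases List.eq_nil_or_concat' l with rfl | ⟨l, b, rfl⟩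
      · exact Or.inr (List.suffix_cons a c)
      rw [List.append_assoc, List.singleton_append] at h hc' ⊢
      obtain ⟨m, hm⟩ := word_append_prefix l (b :: c)
      rw [← hm, word, List.append_assoc, List.append_assoc, List.append_cancel_left_eq] at h
      obtain ⟨rfl, -⟩ := block_prefix_free hc.1.proper hc.2 hc'.of_append.2 h
      exact Or.inl (List.suffix_append l (a :: c))
    · exact Or.inr (hsuf.trans (List.suffix_cons a c))

lemma eq_nil_of_word_append_eq (h : Valid (l ++ c)) (e : word (l ++ c) = word c) : l = [] := by
  cases l with
  | nil => rfl
  | cons a l =>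
    rw [List.cons_append, word] at e
    have := (word_append_prefix l c).eq_of_length_le (by simp [← e])
    rw [← this, List.append_right_eq_self] at e
    exact absurd e (block_ne_nil h.1.proper h.2)

theorem word_injOn : Set.InjOn word {c | Valid c} := by
  intro c hc c' hc' h
  rcases suffix_or_suffix_of_word_append_eq (r := []) (r' := []) hc hc' (by simpa using h) with
    ⟨l, rfl⟩ | ⟨l, rfl⟩
  · rw [eq_nil_of_word_append_eq hc' h.symm, List.nil_append]
  · rw [eq_nil_of_word_append_eq hc h, List.nil_append]

/-! ### The walks of codes are 3-sided -/

lemma mem_visited_append_vert (hz : z ∈ visited (v ++ vert d d')) : z ∈ visited v ∨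
    z.1 = (endpoint v).1 ∧ min (endpoint v).2 ((endpoint v).2 + d - d') ≤ z.2 ∧
      z.2 ≤ max (endpoint v).2 ((endpoint v).2 + d - d') := by
  rcases le_total d d' with h | h
  all_goals
    first | rw [vert_of_le h] at hz | rw [vert_of_ge h] at hz
    refine (mem_visited_append_replicate.1 hz).imp_right ?_
    rintro ⟨j, -, hj, rfl⟩
    simp only [Dir.vec, Prod.fst_add, Prod.snd_add, Prod.smul_fst, Prod.smul_snd, smul_zero,
      smul_neg, nsmul_one]
    omega

lemma mem_visited_append_horiz (hz : z ∈ visited (v ++ horiz p p')) : z ∈ visited v ∨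
    z.2 = (endpoint v).2 ∧ min (endpoint v).1 ((endpoint v).1 + p - p') ≤ z.1 ∧
      z.1 ≤ max (endpoint v).1 ((endpoint v).1 + p - p') := by
  rcases le_total p p' with h | h
  all_goals
    first | rw [horiz_of_le h] at hz | rw [horiz_of_ge h] at hz
    refine (mem_visited_append_replicate.1 hz).imp_right ?_
    rintro ⟨j, -, hj, rfl⟩
    simp only [Dir.vec, Prod.fst_add, Prod.snd_add, Prod.smul_fst, Prod.smul_snd, smul_zero,
      smul_neg, nsmul_one]
    omega

lemma Walk.IsThreeSided.append_vert (h3 : IsThreeSided v)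
    (hcol : ∀ z ∈ visited v, z.1 = (endpoint v).1 → z.2 = (endpoint v).2)
    (hwest : ∀ z ∈ visited v, (endpoint v).1 ≤ z.1) (d d' : ℕ) :
    IsThreeSided (v ++ vert d d') := by
  rcases le_total d d' with h | h
  · rw [vert_of_le h]
    exact h3.append_replicate_vertical (s := .south) rfl (fun z hz e => (hcol z hz e).ge)
      (Or.inl hwest) _
  · rw [vert_of_ge h]
    exact h3.append_replicate_vertical (s := .north) rfl (fun z hz e => (hcol z hz e).le)
      (Or.inl hwest) _

lemma Walk.IsThreeSided.append_horiz (h3 : IsThreeSided v)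
    (hrow : ∀ z ∈ visited v, z.2 = (endpoint v).2 → z.1 = (endpoint v).1)
    (hnorth : ∀ z ∈ visited v, z.2 ≤ (endpoint v).2) (p p' : ℕ) :
    IsThreeSided (v ++ horiz p p') := by
  rcases le_total p p' with h | h
  · rw [horiz_of_le h]
    exact h3.append_replicate_horizontal (s := .west) rfl (fun z hz e => (hrow z hz e).ge) hnorth _
  · rw [horiz_of_ge h]
    exact h3.append_replicate_horizontal (s := .east) rfl (fun z hz e => (hrow z hz e).le) hnorth _

/-- What is known about a walk in the state `column w d t`. -/
structure ColumnInv (v : Walk) (w d t : ℕ) : Prop where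
  three : IsThreeSided v
  fst : (endpoint v).1 = -w
  snd : (endpoint v).2 = t - d
  box : ∀ z ∈ visited v, -(w : ℤ) ≤ z.1 ∧ z.1 ≤ 0 ∧ z.2 ≤ t
  column : ∀ z ∈ visited v, z.1 = -w → z.2 = t - d
  start : w = 0 → v = [] ∧ d = 0 ∧ t = 0
  top : 1 ≤ w → ∃ z ∈ visited v, -(w : ℤ) < z.1 ∧ z.2 = t

/-- What is known about a walk in the state `row w p t`. -/
structure RowInv (v : Walk) (w p t : ℕ) : Prop where
  three : IsThreeSided v
  fst : (endpoint v).1 = -p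
  snd : (endpoint v).2 = t
  le : p ≤ w
  pos : 1 ≤ t
  box : ∀ z ∈ visited v, -(w : ℤ) ≤ z.1 ∧ z.1 ≤ 0 ∧ z.2 ≤ t
  row : ∀ z ∈ visited v, z.2 = t → z.1 = -p
  prev : (-(p : ℤ), (t : ℤ) - 1) ∈ visited v
  west : ∃ z ∈ visited v, z.1 = -(w : ℤ) ∧ z.2 < t

lemma columnInv_nil : ColumnInv [] 0 0 0 := by
  refine ⟨isThreeSided_nil, rfl, rfl, ?_, ?_, by simp, by simp⟩ <;>
    simp [mem_visited_nil]

lemma ColumnInv.isThreeSided_append_vert (h : ColumnInv v w d t) (d₁ d₂ : ℕ) :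
    IsThreeSided (v ++ vert d₁ d₂) := by
  refine h.three.append_vert (fun z hz e => ?_) (fun z hz => ?_) d₁ d₂
  · rw [h.snd, h.column z hz (e.trans h.fst)]
  · rw [h.fst]
    exact (h.box z hz).1

lemma RowInv.isThreeSided_append_horiz (h : RowInv v w p t) (p₁ p₂ : ℕ) :
    IsThreeSided (v ++ horiz p₁ p₂) := by
  refine h.three.append_horiz (fun z hz e => ?_) (fun z hz => ?_) p₁ p₂
  · rw [h.fst, h.row z hz (e.trans h.snd)]
  · rw [h.snd]
    exact (h.box z hz).2.2

lemma ColumnInv.visited_append_vert (h : ColumnInv v w d t)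
    (hz : z ∈ visited (v ++ vert d d')) : -(w : ℤ) ≤ z.1 ∧ z.1 ≤ 0 ∧ z.2 ≤ t := by
  have hfst := h.fst
  have hsnd := h.snd
  rcases mem_visited_append_vert hz with hz | hz
  · exact h.box z hz
  · omega

lemma ColumnInv.endpoint_append_vert (h : ColumnInv v w d t) (d' : ℕ) :
    endpoint (v ++ vert d d') = (-(w : ℤ), (t : ℤ) - d') := by
  ext <;> simp [endpoint_vert, h.fst, h.snd]

lemma RowInv.visited_append_horiz (h : RowInv v w p t) (hp' : p' ≤ w)
    (hz : z ∈ visited (v ++ horiz p p')) : -(w : ℤ) ≤ z.1 ∧ z.1 ≤ 0 ∧ z.2 ≤ t := by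
  have hfst := h.fst
  have hsnd := h.snd
  have hle := h.le
  rcases mem_visited_append_horiz hz with hz | hz
  · exact h.box z hz
  · omega

lemma RowInv.endpoint_append_horiz (h : RowInv v w p t) (p' : ℕ) :
    endpoint (v ++ horiz p p') = (-(p' : ℤ), (t : ℤ)) := by
  ext <;> simp [endpoint_horiz, h.fst, h.snd]
  omega

lemma ColumnInv.dig (h : ColumnInv v w d t) (d' : ℕ) :
    ColumnInv (v ++ (vert d d' ++ [.west])) (w + 1) d' t := by
  have hend := h.endpoint_append_vert d'
  have hend' : endpoint (v ++ vert d d') + Dir.west.vec = (-((w + 1 : ℕ) : ℤ), (t : ℤ) - d') := by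
    ext <;> simp [hend, Dir.vec, add_comm]
  rw [← List.append_assoc]
  refine ⟨(h.isThreeSided_append_vert d d').concat_west fun z hz => ?_, ?_, ?_, fun z hz => ?_,
    fun z hz e => ?_, by simp, fun _ => ?_⟩
  · exact hend ▸ (h.visited_append_vert hz).1
  · rw [endpoint_append, endpoint_singleton, hend']
  · rw [endpoint_append, endpoint_singleton, hend']
  · rcases mem_visited_concat.1 hz with hz | rfl
    · have := h.visited_append_vert hz
      omega
    · rw [hend']
      omega
  · rcases mem_visited_concat.1 hz with hz | rfl
    · have := h.visited_append_vert hz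
      omega
    · rw [hend']
  · rcases Nat.eq_zero_or_pos w with h0 | h0
    · obtain ⟨-, -, rfl⟩ := h.start h0
      exact ⟨0, zero_mem_visited _, by simp only [Prod.fst_zero]; omega, rfl⟩
    · obtain ⟨z, hz, hz1, hz2⟩ := h.top h0
      exact ⟨z, visited_mono (by simp) hz, by omega, hz2⟩

lemma ColumnInv.rise (h : ColumnInv v w d t) :
    RowInv (v ++ vert (d + 1) 0) w w (t + 1) := by
  have hend := h.endpoint_append_vert 0
  have hend' : endpoint (v ++ vert d 0) + Dir.north.vec = (-(w : ℤ), ((t + 1 : ℕ) : ℤ)) := by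
    ext <;> simp [hend, Dir.vec]
  have hvert : v ++ vert (d + 1) 0 = v ++ vert d 0 ++ [.north] := by
    simp [vert, List.replicate_succ']
  rw [hvert]
  refine ⟨(h.isThreeSided_append_vert d 0).concat_north fun z hz => ?_, ?_, ?_, le_rfl,
    t.succ_pos, fun z hz => ?_, fun z hz e => ?_, ?_, ?_⟩
  · simpa [hend] using (h.visited_append_vert hz).2.2
  · rw [endpoint_append, endpoint_singleton, hend']
  · rw [endpoint_append, endpoint_singleton, hend']
  · rcases mem_visited_concat.1 hz with hz | rfl
    · have := h.visited_append_vert hz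
      omega
    · rw [hend']
      omega
  · rcases mem_visited_concat.1 hz with hz | rfl
    · have := h.visited_append_vert hz
      omega
    · rw [hend']
  · refine mem_visited_concat.2 (Or.inl ?_)
    simpa [hend] using endpoint_mem_visited (v ++ vert d 0)
  · refine ⟨endpoint v, visited_mono (by simp) (endpoint_mem_visited v), h.fst, ?_⟩
    rw [h.snd]
    omega

lemma RowInv.shift (h : RowInv v w p t) (hp' : p' ≤ w) :
    RowInv (v ++ (horiz p p' ++ [.north])) w p' (t + 1) := by
  have hend := h.endpoint_append_horiz p'
  have hend' : endpoint (v ++ horiz p p') + Dir.north.vec = (-(p' : ℤ), ((t + 1 : ℕ) : ℤ)) := by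
    ext <;> simp [hend, Dir.vec]
  rw [← List.append_assoc]
  refine ⟨(h.isThreeSided_append_horiz p p').concat_north fun z hz => ?_, ?_, ?_, hp',
    t.succ_pos, fun z hz => ?_, fun z hz e => ?_, ?_, ?_⟩
  · exact hend ▸ (h.visited_append_horiz hp' hz).2.2
  · rw [endpoint_append, endpoint_singleton, hend']
  · rw [endpoint_append, endpoint_singleton, hend']
  · rcases mem_visited_concat.1 hz with hz | rfl
    · have := h.visited_append_horiz hp' hz
      omega
    · rw [hend']
      omega
  · rcases mem_visited_concat.1 hz with hz | rfl
    · have := h.visited_append_horiz hp' hz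
      omega
    · rw [hend']
  · refine mem_visited_concat.2 (Or.inl ?_)
    simpa [hend] using endpoint_mem_visited (v ++ horiz p p')
  · obtain ⟨z, hz, hz1, hz2⟩ := h.west
    exact ⟨z, visited_mono (by simp) hz, hz1, by omega⟩

lemma RowInv.extend (h : RowInv v w p t) : ColumnInv (v ++ horiz p (w + 1)) (w + 1) 0 t := by
  have hend := h.endpoint_append_horiz w
  have hend' : endpoint (v ++ horiz p w) + Dir.west.vec = (-((w + 1 : ℕ) : ℤ), (t : ℤ)) := by
    ext <;> simp [hend, Dir.vec, add_comm]
  have hhoriz : v ++ horiz p (w + 1) = v ++ horiz p w ++ [.west] := by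
    rw [horiz_of_le h.le, horiz_of_le (h.le.trans w.le_succ), Nat.succ_sub h.le,
      List.replicate_succ', List.append_assoc]
  rw [hhoriz]
  refine ⟨(h.isThreeSided_append_horiz p w).concat_west fun z hz => ?_, ?_, ?_, fun z hz => ?_,
    fun z hz e => ?_, by simp, fun _ => ?_⟩
  · exact hend ▸ (h.visited_append_horiz le_rfl hz).1
  · rw [endpoint_append, endpoint_singleton, hend']
  · rw [endpoint_append, endpoint_singleton, hend']
    simp
  · rcases mem_visited_concat.1 hz with hz | rfl
    · have := h.visited_append_horiz le_rfl hz
      omega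
    · rw [hend']
      omega
  · rcases mem_visited_concat.1 hz with hz | rfl
    · have := h.visited_append_horiz le_rfl hz
      omega
    · rw [hend']
      simp
  · refine ⟨endpoint v, visited_mono (by simp) (endpoint_mem_visited v), ?_, h.snd⟩
    have := h.le
    rw [h.fst]
    omega

/-- What is known about a walk in a given state. -/
def Inv (v : Walk) : State → Prop
  | .column w d t => ColumnInv v w d t
  | .row w p t => RowInv v w p t

theorem inv_word (hc : Valid c) : Inv (word c) (state c) := by
  induction c with
  | nil => exact columnInv_nil
  | cons a c ih =>
    have hI := ih hc.1
    have ha := hc.2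
    rw [word, state]
    cases hst : state c <;> rw [hst] at hI ha <;> cases a <;> simp only [Allowed] at ha
    · exact ColumnInv.dig hI _
    · exact ColumnInv.rise hI
    · exact RowInv.shift hI ha
    · exact RowInv.extend hI

lemma columnInv_word (hc : Valid c) (hst : state c = .column w d t) :
    ColumnInv (word c) w d t := by
  have := inv_word hc
  rwa [hst] at this

lemma rowInv_word (hc : Valid c) (hst : state c = .row w p t) : RowInv (word c) w p t := by
  have := inv_word hc
  rwa [hst] at this

end Codes

section Surjectivity

/-! ### Every 3-sided walk in the half-plane `x ≤ 0` comes from a code -/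

variable {c : List Letter} {u v : Walk} {s s' : Dir} {w d d' p p' t k : ℕ}

/-- The walk consists of the walk of a code and a straight run which is a part of the next block. -/
inductive Coded (u : Walk) : Prop
  | column (c : List Letter) (w d d' t : ℕ) (hc : Valid c) (hst : state c = .column w d t)
      (hu : u = word c ++ vert d d')
  | row (c : List Letter) (w p p' t : ℕ) (hc : Valid c) (hst : state c = .row w p t)
      (hp' : p' ≤ w) (hu : u = word c ++ horiz p p')

lemma Coded.of_column (hc : Valid c) (hst : state c = .column w d t) : Coded (word c) :=
  .column c w d d t hc hst (by simp [vert])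

lemma Coded.of_row (hc : Valid c) (hst : state c = .row w p t) : Coded (word c) :=
  .row c w p p t hc hst (rowInv_word hc hst).le (by simp [horiz])

lemma Walk.not_admissible_append_replicate (hs : s'.vec = -s.vec) (hk : 0 < k) :
    ¬ Admissible (v ++ List.replicate k s) s' := by
  intro h
  obtain ⟨k, rfl⟩ := Nat.exists_eq_add_of_lt hk
  rw [zero_add, List.replicate_succ', ← List.append_assoc] at h
  refine h.notMem_visited (visited_mono (List.prefix_append _ _) ?_)
  rw [endpoint_append _ [s], endpoint_singleton, hs, add_neg_cancel_right]
  exact endpoint_mem_visited _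

lemma le_of_admissible_append_vert_north (h : Admissible (v ++ vert d d') .north) : d' ≤ d := by
  by_contra! hlt
  rw [vert_of_le hlt.le] at h
  exact not_admissible_append_replicate (by simp [Dir.vec]) (Nat.sub_pos_of_lt hlt) h

lemma le_of_admissible_append_vert_south (h : Admissible (v ++ vert d d') .south) : d ≤ d' := by
  by_contra! hlt
  rw [vert_of_ge hlt.le] at h
  exact not_admissible_append_replicate (by simp [Dir.vec]) (Nat.sub_pos_of_lt hlt) h

lemma le_of_admissible_append_horiz_east (h : Admissible (v ++ horiz p p') .east) : p' ≤ p := by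
  by_contra! hlt
  rw [horiz_of_le hlt.le] at h
  exact not_admissible_append_replicate (by simp [Dir.vec]) (Nat.sub_pos_of_lt hlt) h

lemma le_of_admissible_append_horiz_west (h : Admissible (v ++ horiz p p') .west) : p ≤ p' := by
  by_contra! hlt
  rw [horiz_of_ge hlt.le] at h
  exact not_admissible_append_replicate (by simp [Dir.vec]) (Nat.sub_pos_of_lt hlt) h

lemma vert_concat_north (h : d' + 1 ≤ d) : vert d (d' + 1) ++ [.north] = vert d d' := by
  rw [vert_of_ge h, vert_of_ge (Nat.le_of_succ_le h), ← List.replicate_succ']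
  congr 1
  omega

lemma vert_concat_south (h : d ≤ d') : vert d d' ++ [.south] = vert d (d' + 1) := by
  rw [vert_of_le h, vert_of_le (h.trans d'.le_succ), ← List.replicate_succ', Nat.succ_sub h]

lemma horiz_concat_east (h : p' + 1 ≤ p) : horiz p (p' + 1) ++ [.east] = horiz p p' := by
  rw [horiz_of_ge h, horiz_of_ge (Nat.le_of_succ_le h), ← List.replicate_succ']
  congr 1
  omega

lemma horiz_concat_west (h : p ≤ p') : horiz p p' ++ [.west] = horiz p (p' + 1) := by
  rw [horiz_of_le h, horiz_of_le (h.trans p'.le_succ), ← List.replicate_succ', Nat.succ_sub h]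

/-- The step to the east would leave the half-plane, or be one towards the top row of the earlier
columns, or (below the top row) not lead to the boundary of the box. -/
lemma ColumnInv.not_admissible_east (h : ColumnInv v w d t)
    (hx : (endpoint (v ++ vert d d') + Dir.east.vec).1 ≤ 0) :
    ¬ Admissible (v ++ vert d d') .east := by
  intro ha
  have hend := h.endpoint_append_vert d'
  have hw : 1 ≤ w := by
    rw [hend] at hx
    simp only [Prod.fst_add, Dir.vec] at hx
    omega
  obtain ⟨z, hz, hz1, hz2⟩ := h.top hw
  replace hz : z ∈ visited (v ++ vert d d') := visited_mono (List.prefix_append _ _) hz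
  have hle : z.1 ≤ (endpoint (v ++ vert d d')).1 := by
    rcases Nat.eq_zero_or_pos d' with rfl | hd'
    · exact ha.free z hz (by simp [hend, hz2])
    · refine ha.east_extends (h.isThreeSided_append_vert d d') hz ?_ z hz
      rw [hend]
      omega
  rw [hend] at hle
  omega

lemma RowInv.exists_below (h : RowInv v w p t) (hp' : p' ≤ w) :
    ∃ z ∈ visited v, z.1 = -p' ∧ z.2 < t := by
  rcases eq_or_ne p' p with rfl | hne
  · exact ⟨_, h.prev, rfl, by omega⟩
  · obtain ⟨z, hz, hz1, -⟩ := h.west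
    obtain ⟨y, hy, hy1⟩ := exists_mem_visited_fst_eq (x := -p') hz (zero_mem_visited v)
      (by omega) (by simp)
    refine ⟨y, hy, hy1, lt_of_le_of_ne (h.box y hy).2.2 fun e => ?_⟩
    have := h.row y hy e
    omega

lemma RowInv.not_admissible_south (h : RowInv v w p t) (hp' : p' ≤ w) :
    ¬ Admissible (v ++ horiz p p') .south := by
  intro ha
  obtain ⟨z, hz, hz1, hz2⟩ := h.exists_below hp'
  have := ha.free z (visited_mono (List.prefix_append _ _) hz)
  rw [h.endpoint_append_horiz] at this
  exact (this hz1).not_gt hz2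

lemma Coded.concat_of_column (hc : Valid c) (hst : state c = .column w d t)
    (ha : Admissible (word c ++ vert d d') s)
    (hx : (endpoint (word c ++ vert d d') + s.vec).1 ≤ 0) :
    Coded (word c ++ vert d d' ++ [s]) := by
  have hinv := columnInv_word hc hst
  rw [List.append_assoc]
  cases s with
  | north =>
    have hd := le_of_admissible_append_vert_north ha
    cases d' with
    | zero =>
      have hword : word c ++ (vert d 0 ++ [.north]) = word (.rise :: c) := by
        simp [word, hst, block, vert, List.replicate_succ']
      rw [hword]
      exact .of_row (w := w) (p := w) (t := t + 1) ⟨hc, by simp [hst, Allowed]⟩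
        (by simp [state, hst, next])
    | succ d' =>
      rw [vert_concat_north hd]
      exact .column c w d d' t hc hst rfl
  | south =>
    rw [vert_concat_south (le_of_admissible_append_vert_south ha)]
    exact .column c w d (d' + 1) t hc hst rfl
  | west =>
    have hword : word c ++ (vert d d' ++ [.west]) = word (.dig d' :: c) := by
      simp [word, hst, block]
    rw [hword]
    exact .of_column (w := w + 1) (d := d') (t := t) ⟨hc, by simp [hst, Allowed]⟩
      (by simp [state, hst, next])
  | east => exact absurd ha (hinv.not_admissible_east hx)

lemma Coded.concat_of_row (hc : Valid c) (hst : state c = .row w p t) (hp' : p' ≤ w)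
    (ha : Admissible (word c ++ horiz p p') s)
    (hx : (endpoint (word c ++ horiz p p') + s.vec).1 ≤ 0) :
    Coded (word c ++ horiz p p' ++ [s]) := by
  have hinv := rowInv_word hc hst
  rw [List.append_assoc]
  cases s with
  | north =>
    have hword : word c ++ (horiz p p' ++ [.north]) = word (.shift p' :: c) := by
      simp [word, hst, block]
    rw [hword]
    exact .of_row (w := w) (p := p') (t := t + 1) ⟨hc, by simpa [hst, Allowed] using hp'⟩
      (by simp [state, hst, next])
  | east =>
    have hp := le_of_admissible_append_horiz_east ha
    cases p' with
    | zero => simp [hinv.endpoint_append_horiz, Dir.vec] at hx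
    | succ p' =>
      rw [horiz_concat_east hp]
      exact .row c w p p' t hc hst (Nat.le_of_succ_le hp') rfl
  | west =>
    rw [horiz_concat_west (le_of_admissible_append_horiz_west ha)]
    rcases hp'.eq_or_lt with rfl | hlt
    · have hword : word c ++ horiz p (p' + 1) = word (.extend :: c) := by
        simp [word, hst, block]
      rw [hword]
      exact .of_column (w := p' + 1) (d := 0) (t := t) ⟨hc, by simp [hst, Allowed]⟩
        (by simp [state, hst, next])
    · exact .row c w p (p' + 1) t hc hst hlt rfl
  | south => exact absurd ha (hinv.not_admissible_south hp')

theorem coded_of_isThreeSided (h : IsThreeSided u) (hx : ∀ z ∈ visited u, z.1 ≤ 0) :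
    Coded u := by
  induction u using List.reverseRecOn with
  | nil => exact .of_column (c := []) trivial rfl
  | append_singleton u s ih =>
    obtain ⟨h3, ha⟩ := isThreeSided_concat.1 h
    have hxs := hx _ (mem_visited_concat.2 (Or.inr rfl))
    rcases ih h3 fun z hz => hx z (mem_visited_concat.2 (Or.inl hz)) with
      ⟨c, w, d, d', t, hc, hst, rfl⟩ | ⟨c, w, p, p', t, hc, hst, hp', rfl⟩
    · exact .concat_of_column hc hst ha hxs
    · exact .concat_of_row hc hst hp' ha hxs

end Surjectivity

section Families

lemma mirror_mem {n : ℕ} {w : Walk} (h : w ∈ threeSidedPolygons n) :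
    w.mirror ∈ threeSidedPolygons n := by
  obtain ⟨⟨-, hlen, s, hs⟩, h3, harea⟩ := h
  refine ⟨⟨h3.mirror.1.1, by rwa [length_mirror], s.mirror, ?_⟩, h3.mirror, ?_⟩
  · rw [length_mirror, pos_mirror, hs, Dir.vec_mirror]
  · rw [area_mirror, harea]

/-! ### Three families of polygons -/

variable {c : List Letter} {v : Walk} {w d d' p p' t : ℕ}

/-- The area enclosed between the walk of a code of weight `a` with the given state and the line
`x = 1`. -/
def signedWeight (a : ℕ) : State → ℤ
  | .column w d _ => a - (w + 1) * d
  | .row _ _ _ => a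

lemma signedArea_append_vert (v : Walk) (d d' : ℕ) :
    signedArea (v ++ vert d d') = signedArea v + (endpoint v).1 * (d - d') := by
  rcases le_total d d' with h | h
  · rw [vert_of_le h, signedArea_append_replicate, Nat.cast_sub h]
    simp only [Dir.vec]
    ring
  · rw [vert_of_ge h, signedArea_append_replicate, Nat.cast_sub h]
    simp only [Dir.vec]
    ring

lemma signedArea_append_horiz (v : Walk) (p p' : ℕ) :
    signedArea (v ++ horiz p p') = signedArea v := by
  simp [horiz, ← List.append_assoc, signedArea_append_replicate, Dir.vec]

lemma endpoint_snd_sub_signedArea_word (hc : Valid c) :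
    (endpoint (word c)).2 - signedArea (word c) = signedWeight (weight c) (state c) := by
  induction c with
  | nil => simp [word, weight, state, signedWeight]
  | cons a c ih =>
    have hinv := inv_word hc.1
    have ha := hc.2
    replace ih := ih hc.1
    rw [word, state, weight]
    cases hst : state c <;> rw [hst] at hinv ha ih <;> cases a <;> simp only [Allowed] at ha <;>
      have hfst := hinv.fst <;>
      simp only [block, next, letterWeight, signedWeight, ← List.append_assoc, signedArea_concat,
        signedArea_append_vert, signedArea_append_horiz, endpoint_append, endpoint_vert,
        endpoint_horiz, endpoint_singleton, hfst, Dir.vec, Prod.fst_add, Prod.snd_add] at ih ⊢ <;>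
      push_cast <;> linear_combination ih

/-- The polygon of a code that leads to a state `row w p t`: the walk continues on the top row to
the column `x = 1` and returns there to the level of the origin. -/
def closing (c : List Letter) : Walk :=
  match state c with
  | .row _ p t => word c ++ List.replicate (p + 1) .east ++ List.replicate t .south
  | .column _ _ _ => []

/-- The polygon that is a single column, described counterclockwise. -/
def columnPolygon (n : ℕ) : Walk :=
  List.replicate n .south ++ [.east] ++ List.replicate n .north

/-- The polygon consisting of columns of depths `d + 1`, hanging from the row `y = 1`. -/
def hanging (ds : List ℕ) : Walk :=
  word (.rise :: ds.map .dig) ++ List.replicate ds.length .east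

lemma mem_threeSidedPolygons_of_isThreeSided (h : IsThreeSided v) (hl : v.length ≠ 1) {s : Dir}
    (hs : endpoint v = s.vec) : v ∈ threeSidedPolygons (signedArea v).natAbs :=
  ⟨⟨h.1.1, hl, s, by rw [pos_length, hs]⟩, h, area_eq hs⟩

lemma closing_eq (hst : state c = .row w p t) :
    closing c = word c ++ List.replicate (p + 1) .east ++ List.replicate t .south := by
  rw [closing, hst]

lemma endpoint_closing (hc : Valid c) (hst : state c = .row w p t) :
    endpoint (closing c) = (1, 0) := by
  have hinv := rowInv_word hc hst
  rw [closing_eq hst]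
  ext <;> simp [hinv.fst, hinv.snd, Dir.vec]

lemma signedArea_closing (hc : Valid c) (hst : state c = .row w p t) :
    signedArea (closing c) = -weight c := by
  have hinv := rowInv_word hc hst
  have harea := endpoint_snd_sub_signedArea_word hc
  rw [hst, signedWeight, hinv.snd] at harea
  rw [closing_eq hst, signedArea_append_replicate, signedArea_append_replicate, endpoint_append,
    endpoint_replicate, Prod.fst_add, hinv.fst, Prod.smul_fst]
  simp only [Dir.vec, nsmul_one]
  push_cast
  linear_combination -harea

lemma RowInv.isThreeSided_append_east (h : RowInv v w p t) (k : ℕ) :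
    IsThreeSided (v ++ List.replicate k .east) := by
  refine h.three.append_replicate_horizontal rfl (fun z hz e => ?_) (fun z hz => ?_) k
  · rw [h.row z hz (e.trans h.snd), h.fst]
  · rw [h.snd]
    exact (h.box z hz).2.2

lemma closing_mem (hc : Valid c) (hst : state c = .row w p t) :
    closing c ∈ threeSidedPolygons (weight c) := by
  have hinv := rowInv_word hc hst
  have hend : endpoint (word c ++ List.replicate (p + 1) .east) = (1, (t : ℤ)) := by
    ext <;> simp [Dir.vec, hinv.fst, hinv.snd]
  have hvisited : ∀ z ∈ visited (word c ++ List.replicate (p + 1) .east),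
      z.1 ≤ 1 ∧ (z.1 = 1 → z.2 = t) := by
    intro z hz
    rcases mem_visited_append_replicate.1 hz with hz | ⟨j, -, hj, rfl⟩
    · have := hinv.box z hz
      omega
    · simp [Dir.vec, hinv.fst, hinv.snd]
      omega
  have hthree : IsThreeSided (closing c) := by
    rw [closing_eq hst]
    refine (hinv.isThreeSided_append_east (p + 1)).append_replicate_vertical rfl
      (fun z hz e => ?_) (Or.inr fun z hz => ?_) t <;> rw [hend] at *
    · exact ((hvisited z hz).2 e).ge
    · exact (hvisited z hz).1
  have hlen : (closing c).length ≠ 1 := by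
    have := hinv.pos
    simp only [closing_eq hst, List.length_append, List.length_replicate]
    omega
  simpa [signedArea_closing hc hst] using
    mem_threeSidedPolygons_of_isThreeSided hthree hlen (s := .east) (endpoint_closing hc hst)

lemma endpoint_columnPolygon (n : ℕ) : endpoint (columnPolygon n) = (1, 0) := by
  rw [columnPolygon, endpoint_append, endpoint_append, endpoint_replicate, endpoint_replicate,
    endpoint_singleton]
  ext <;> simp [Dir.vec]

lemma columnPolygon_eq (n : ℕ) : columnPolygon n =
    [] ++ List.replicate n .south ++ [.east] ++ List.replicate n .north := rfl

lemma signedArea_columnPolygon (n : ℕ) : signedArea (columnPolygon n) = n := by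
  rw [columnPolygon_eq, signedArea_append_replicate, signedArea_concat,
    signedArea_append_replicate]
  simp [Dir.vec]

lemma isThreeSided_columnPolygon (n : ℕ) : IsThreeSided (columnPolygon n) := by
  have hdown : IsThreeSided ([] ++ List.replicate n .south) :=
    isThreeSided_nil.append_replicate_vertical (s := .south) rfl (by simp [Free, mem_visited_nil])
      (by simp [mem_visited_nil]) n
  have hcol : ∀ z ∈ visited ([] ++ List.replicate n .south), z.1 = 0 := by
    intro z hz
    rcases mem_visited_append_replicate.1 hz with hz | ⟨j, -, -, rfl⟩
    · simp [mem_visited_nil.1 hz]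
    · simp [Dir.vec]
  have heast := hdown.concat_east fun z hz => by simp [hcol z hz, Dir.vec]
  have hvisited : ∀ z ∈ visited ([] ++ List.replicate n .south ++ [.east]),
      z.1 = 0 ∨ z = endpoint ([] ++ List.replicate n .south ++ [.east]) := by
    intro z hz
    rw [endpoint_append _ [.east], endpoint_singleton]
    exact (mem_visited_concat.1 hz).imp_left (hcol z)
  have hend : (endpoint ([] ++ List.replicate n .south ++ [.east])).1 = 1 := by simp [Dir.vec]
  refine heast.append_replicate_vertical rfl (fun z hz e => ?_) (Or.inr fun z hz => ?_) n
  · rcases hvisited z hz with h | rfl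
    · omega
    · rfl
  · rcases hvisited z hz with h | rfl
    · omega
    · rfl

lemma columnPolygon_mem {n : ℕ} (hn : 1 ≤ n) : columnPolygon n ∈ threeSidedPolygons n := by
  have hlen : (columnPolygon n).length ≠ 1 := by
    simp [columnPolygon]
    omega
  simpa [signedArea_columnPolygon] using mem_threeSidedPolygons_of_isThreeSided
    (isThreeSided_columnPolygon n) hlen (s := .east) (endpoint_columnPolygon n)

lemma state_digs (ds : List ℕ) :
    state (ds.map .dig) = .column ds.length (ds.headD 0) 0 := by
  induction ds with
  | nil => rfl
  | cons d ds ih =>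
    rw [List.map_cons, state, ih]
    rfl

lemma valid_digs (ds : List ℕ) : Valid (ds.map .dig) := by
  induction ds with
  | nil => trivial
  | cons d ds ih => exact ⟨ih, by rw [state_digs]; trivial⟩

lemma weight_digs (ds : List ℕ) : weight (ds.map .dig) = ds.sum := by
  induction ds with
  | nil => rfl
  | cons d ds ih =>
    rw [List.map_cons, weight, state_digs, ih, List.sum_cons, letterWeight, add_comm]

lemma valid_rise_digs (ds : List ℕ) : Valid (.rise :: ds.map .dig) :=
  ⟨valid_digs ds, by rw [state_digs]; trivial⟩

lemma state_rise_digs (ds : List ℕ) :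
    state (.rise :: ds.map .dig) = .row ds.length ds.length 1 := by
  rw [state, state_digs]
  rfl

lemma rowInv_rise_digs (ds : List ℕ) :
    RowInv (word (.rise :: ds.map .dig)) ds.length ds.length 1 :=
  rowInv_word (valid_rise_digs ds) (state_rise_digs ds)

lemma endpoint_hanging (ds : List ℕ) : endpoint (hanging ds) = (0, 1) := by
  have hinv := rowInv_rise_digs ds
  ext <;> simp [hanging, hinv.fst, hinv.snd, Dir.vec]

lemma signedArea_hanging (ds : List ℕ) :
    signedArea (hanging ds) = -((ds.sum + ds.length : ℕ) : ℤ) := by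
  have harea := endpoint_snd_sub_signedArea_word (valid_rise_digs ds)
  rw [(rowInv_rise_digs ds).snd, state_rise_digs, weight, weight_digs, state_digs, letterWeight,
    signedWeight] at harea
  rw [hanging, signedArea_append_replicate]
  simp only [Dir.vec]
  push_cast at harea ⊢
  linear_combination -harea

lemma hanging_mem {ds : List ℕ} (hds : ds ≠ []) :
    hanging ds ∈ threeSidedPolygons (ds.sum + ds.length) := by
  have hlen : (hanging ds).length ≠ 1 := by
    have := List.length_pos_iff.2 hds
    rw [hanging, word, state_digs, block]
    simp [vert]
    omega
  have hmem := mem_threeSidedPolygons_of_isThreeSided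
    ((rowInv_rise_digs ds).isThreeSided_append_east ds.length) hlen (s := .north)
    (endpoint_hanging ds)
  have harea : (signedArea (hanging ds)).natAbs = ds.sum + ds.length := by
    rw [signedArea_hanging, Int.natAbs_neg, Int.natAbs_natCast]
  rw [← harea]
  exact hmem

end Families

section Classification

/-! ### Classification of 3-sided prudent polygons -/

variable {c : List Letter} {u v w : Walk} {s : Dir} {x y : ℤ} {z : ℤ × ℤ}

lemma Walk.IsSelfAvoiding.prefix_eq_of_endpoint_eq {p p' : Walk} (hw : w.IsSelfAvoiding)
    (h : p <+: w) (h' : p' <+: w) (he : endpoint p = endpoint p') : p = p' := by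
  have pos_eq {p : Walk} (h : p <+: w) : w.pos p.length = endpoint p := by
    rw [pos, ← List.prefix_iff_eq_take.1 h, endpoint]
  have hlen := hw _ h.length_le _ h'.length_le (by rw [pos_eq h, pos_eq h', he])
  rw [List.prefix_iff_eq_take.1 h, List.prefix_iff_eq_take.1 h', hlen]

lemma Walk.IsThreeSided.endpoint_ne_zero (h : IsThreeSided w) (hw : w ≠ []) : endpoint w ≠ 0 :=
  fun he => hw (h.1.1.prefix_eq_of_endpoint_eq List.prefix_rfl List.nil_prefix he)

lemma Walk.exists_first_east (hz : z ∈ visited u) (h : 1 ≤ z.1) :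
    ∃ v, v ++ [.east] <+: u ∧ (∀ x ∈ visited v, x.1 ≤ 0) ∧ (endpoint v).1 = 0 := by
  induction u using List.reverseRecOn generalizing z with
  | nil => simp [mem_visited_nil.1 hz] at h
  | append_singleton u s ih =>
    by_cases! hu : ∃ x ∈ visited u, 1 ≤ x.1
    · obtain ⟨x, hx, hx1⟩ := hu
      obtain ⟨v, hv, hvx⟩ := ih hx hx1
      exact ⟨v, hv.trans (List.prefix_append u [s]), hvx⟩
    · have he := hu _ (endpoint_mem_visited u)
      rcases mem_visited_concat.1 hz with hz | rfl
      · exact absurd (hu z hz) h.not_gt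
      have hs : s = .east := by
        cases s <;> simp [Dir.vec] at h ⊢ <;> omega
      subst hs
      simp only [Prod.fst_add, Dir.vec] at h
      exact ⟨u, List.prefix_rfl, fun x hx => Int.lt_add_one_iff.1 (hu x hx), by omega⟩

lemma Walk.exists_west_of_leaves (hz : z ∈ visited u) (h : 1 ≤ z.1) (he : (endpoint u).1 ≤ 0) :
    ∃ v, v ++ [.west] <+: u ∧ (endpoint v).1 = 1 := by
  induction u using List.reverseRecOn with
  | nil => simp [mem_visited_nil.1 hz] at h
  | append_singleton u s ih =>
    rw [endpoint_append, endpoint_singleton] at he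
    by_cases hu : (endpoint u).1 ≤ 0
    · have hz : z ∈ visited u := by
        rcases mem_visited_concat.1 hz with hz | rfl
        · exact hz
        · omega
      obtain ⟨v, hv, hv1⟩ := ih hz hu
      exact ⟨v, hv.trans (List.prefix_append u [s]), hv1⟩
    · have hs : s = .west := by
        cases s <;> simp [Dir.vec] at he ⊢ <;> omega
      subst hs
      simp only [Prod.fst_add, Dir.vec] at he
      exact ⟨u, List.prefix_rfl, by omega⟩

/-- Backward induction: each node of the run is entered from the preceding one, hence the walk ends
with the whole run. -/
lemma Walk.IsThreeSided.eq_append_replicate {n : ℕ} (h : IsThreeSided w) (hv : v <+: w)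
    (he : endpoint w = endpoint v + n • s.vec)
    (hlast : ∀ u r, ∀ k < n, v <+: u → u ++ [r] <+: w →
      endpoint u + r.vec = endpoint v + (k + 1) • s.vec → r = s) :
    w = v ++ List.replicate n s := by
  induction n generalizing w with
  | zero => simpa using (h.1.1.prefix_eq_of_endpoint_eq hv List.prefix_rfl (by simp [he])).symm
  | succ n ih =>
    have hne : w ≠ v := by
      rintro rfl
      cases s <;> simp [Dir.vec, Prod.ext_iff] at he <;> omega
    rcases List.eq_nil_or_concat' w with rfl | ⟨u, r, rfl⟩
    · exact absurd (List.prefix_nil.1 hv).symm hne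
    have hvu : v <+: u := (List.prefix_concat_iff.1 hv).resolve_left hne.symm
    rw [endpoint_append, endpoint_singleton] at he
    obtain rfl := hlast u r n n.lt_succ_self hvu List.prefix_rfl he
    have hu : u = v ++ List.replicate n r := by
      refine ih (h.of_prefix (List.prefix_append u _)) hvu ?_ fun u' r' k hk hvu' hu' =>
        hlast u' r' k (hk.trans n.lt_succ_self) hvu' (hu'.trans (List.prefix_append u _))
      rw [succ_nsmul, ← add_assoc] at he
      exact add_right_cancel he
    rw [hu, List.replicate_succ', List.append_assoc]

lemma Walk.eq_south_of_endpoint_add (h : IsThreeSided (u ++ [s])) (hx : ∀ z ∈ visited u, z.1 ≤ 1)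
    (hm : (1, x) ∈ visited u) (he : endpoint u + s.vec = (1, y)) (hy : y < x) : s = .south := by
  obtain ⟨hu, hs⟩ := isThreeSided_concat.1 h
  have he1 := congrArg Prod.fst he
  have he2 := congrArg Prod.snd he
  have hend := hx _ (endpoint_mem_visited u)
  cases s <;> simp only [Dir.vec, Prod.fst_add, Prod.snd_add] at he1 he2
  · have := hs.free _ hm (by simp only; omega)
    simp only at this
    omega
  · have := hs.east_extends hu hm (by simp only; omega) _ hm
    simp only at this
    omega
  · rfl
  · omega

lemma Walk.eq_north_of_endpoint_add (h : IsThreeSided (u ++ [s])) (hx : ∀ z ∈ visited u, z.1 ≤ 1)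
    (hm : (1, x) ∈ visited u) (he : endpoint u + s.vec = (1, y)) (hxy : x < y) (hy : y ≤ 0) :
    s = .north := by
  obtain ⟨hu, hs⟩ := isThreeSided_concat.1 h
  have he1 := congrArg Prod.fst he
  have he2 := congrArg Prod.snd he
  have hend := hx _ (endpoint_mem_visited u)
  have hne : endpoint u ≠ 0 := hu.endpoint_ne_zero fun hnil => by
    simp [hnil, mem_visited_nil] at hm
  cases s <;> simp only [Dir.vec, Prod.fst_add, Prod.snd_add] at he1 he2
  · rfl
  · have hlt : (endpoint u).2 < 0 :=
      lt_of_le_of_ne (by omega) fun h2 => hne (Prod.ext (by simp only [Prod.fst_zero]; omega) h2)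
    have := hs.east_extends hu (zero_mem_visited u) hlt _ hm
    simp only at this
    omega
  · have := hs.free _ hm (by simp only; omega)
    simp only at this
    omega
  · omega

lemma eq_append_south_run {n : ℕ} (h : IsThreeSided w) (hx : ∀ z ∈ visited w, z.1 ≤ 1)
    (hv : v ++ [.east] <+: w) (hev : endpoint v = (0, (n : ℤ))) (hew : endpoint w = (1, 0)) :
    w = v ++ [.east] ++ List.replicate n .south := by
  have hend : endpoint (v ++ [.east]) = (1, (n : ℤ)) := by simp [hev, Dir.vec]
  refine h.eq_append_replicate hv (by simp [hend, hew, Dir.vec]) fun u r k _ hvu hu he => ?_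
  refine eq_south_of_endpoint_add (x := n) (y := n - (k + 1)) (h.of_prefix hu)
    (fun z hz => hx z (visited_mono ((List.prefix_append u _).trans hu) hz))
    (hend ▸ visited_mono hvu (endpoint_mem_visited _)) ?_ (by omega)
  rw [he, hend]
  ext <;> simp [Dir.vec]
  ring

lemma eq_append_north_run {n : ℕ} (h : IsThreeSided w) (hx : ∀ z ∈ visited w, z.1 ≤ 1)
    (hv : v ++ [.east] <+: w) (hev : endpoint v = (0, -(n : ℤ))) (hew : endpoint w = (1, 0)) :
    w = v ++ [.east] ++ List.replicate n .north := by
  have hend : endpoint (v ++ [.east]) = (1, -(n : ℤ)) := by simp [hev, Dir.vec]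
  refine h.eq_append_replicate hv (by simp [hend, hew, Dir.vec]) fun u r k hk hvu hu he => ?_
  refine eq_north_of_endpoint_add (x := -n) (y := -n + (k + 1)) (h.of_prefix hu)
    (fun z hz => hx z (visited_mono ((List.prefix_append u _).trans hu) hz))
    (hend ▸ visited_mono hvu (endpoint_mem_visited _)) ?_ (by omega) (by omega)
  rw [he, hend]
  ext <;> simp [Dir.vec]

lemma polygon_last_ne {d : Dir} (h : IsThreeSided (u ++ [s])) (hl : (u ++ [s]).length ≠ 1)
    (hd : endpoint (u ++ [s]) = d.vec) : s.vec ≠ d.vec ∧ s.vec ≠ -d.vec := by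
  obtain ⟨hu, hs⟩ := isThreeSided_concat.1 h
  rw [endpoint_append, endpoint_singleton] at hd
  refine ⟨fun e => ?_, fun e => ?_⟩
  · refine hu.endpoint_ne_zero (fun hnil => hl (by simp [hnil])) ?_
    rwa [e, add_eq_right] at hd
  · refine free_iff.1 hs.free _ (zero_mem_visited u) 2 one_le_two ?_
    rw [two_nsmul, ← add_assoc, hd, e, add_neg_cancel]

lemma fst_le_one_of_endpoint_east (h : IsThreeSided w) (hl : w.length ≠ 1)
    (he : endpoint w = (1, 0)) : ∀ z ∈ visited w, z.1 ≤ 1 := by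
  rcases List.eq_nil_or_concat' w with rfl | ⟨u, s, rfl⟩
  · simp [Prod.ext_iff] at he
  obtain ⟨hu, hs⟩ := isThreeSided_concat.1 h
  have hne := polygon_last_ne h hl (d := .east) he
  rw [endpoint_append, endpoint_singleton] at he
  suffices ∀ z ∈ visited u, z.1 ≤ 1 by
    intro z hz
    rcases mem_visited_concat.1 hz with hz | rfl
    · exact this z hz
    · rw [he]
  have hzero := zero_mem_visited u
  cases s
  · have hend : endpoint u = (1, -1) := by rw [← add_sub_cancel_right (endpoint u), he]; rfl
    rcases hu.onSide with hside | hside | hside <;> rw [hend] at hside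
    · exact absurd (hside _ hzero) (by simp)
    · exact hside
    · exact absurd (hside _ hzero) (by simp)
  · simp at hne
  · have hend : endpoint u = (1, 1) := by rw [← add_sub_cancel_right (endpoint u), he]; rfl
    have hmem := endpoint_mem_visited u
    rcases hs.onSide with hside | hside | hside <;> rw [he] at hside
    · exact absurd (hside _ hmem) (by simp [hend])
    · exact hside
    · exact absurd (hside _ hzero) (by simp)
  · simp [Dir.vec] at hne

/-- One half of the 3-sided prudent polygons; the other half is obtained by reflection. -/
inductive IsBasic (w : Walk) : Prop
  | closing (c : List Letter) (hc : Valid c) (m p t : ℕ) (hst : state c = .row m p t)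
      (h : w = closing c)
  | column (n : ℕ) (hn : 1 ≤ n) (h : w = columnPolygon n)
  | hanging (ds : List ℕ) (hds : ds ≠ []) (h : w = hanging ds)

lemma isBasic_of_endpoint_east (h : IsThreeSided w) (hl : w.length ≠ 1)
    (he : endpoint w = (1, 0)) : IsBasic w := by
  have hx := fst_le_one_of_endpoint_east h hl he
  obtain ⟨v, hvw, hv, hv0⟩ := exists_first_east (endpoint_mem_visited w) (by rw [he])
  cases coded_of_isThreeSided (h.of_prefix ((List.prefix_append v _).trans hvw)) hv with
  | column c m d d' t hc hst hu =>
    have hinv := columnInv_word hc hst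
    have hend : endpoint v = (-(m : ℤ), (t : ℤ) - d') := hu ▸ hinv.endpoint_append_vert d'
    obtain rfl : m = 0 := by simpa [hend] using hv0
    obtain ⟨hnil, rfl, rfl⟩ := hinv.start rfl
    have hw := eq_append_north_run (n := d') h hx hvw (by simp [hend]) he
    rw [hu, hnil, List.nil_append, vert_of_le d'.zero_le] at hw
    refine .column d' (Nat.one_le_iff_ne_zero.2 fun h0 => hl ?_) hw
    simp [hw, h0]
  | row c m p p' t hc hst hp' hu =>
    have hend : endpoint v = (-(p' : ℤ), (t : ℤ)) :=
      hu ▸ (rowInv_word hc hst).endpoint_append_horiz p'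
    obtain rfl : p' = 0 := by simpa [hend] using hv0
    refine .closing c hc m p t hst ?_
    rw [eq_append_south_run (n := t) h hx hvw (by simp [hend]) he, hu, closing_eq hst,
      horiz_of_ge p.zero_le, List.replicate_succ' (n := p), Nat.sub_zero,
      List.append_assoc (word c)]

lemma eq_digs_of_state {m d : ℕ} (hc : Valid c) (hst : state c = .column m d 0) :
    ∃ ds : List ℕ, c = ds.map .dig := by
  induction c generalizing m d with
  | nil => exact ⟨[], rfl⟩
  | cons a c ih =>
    have ha := hc.2
    rw [state] at hst
    cases h : state c with
    | column m' d' t' =>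
      rw [h] at hst ha
      cases a <;> simp only [Allowed] at ha <;>
        simp only [next, State.column.injEq, reduceCtorEq] at hst
      obtain ⟨-, -, rfl⟩ := hst
      obtain ⟨ds, rfl⟩ := ih hc.1 h
      exact ⟨_ :: ds, rfl⟩
    | row m' p' t' =>
      have hpos := (rowInv_word hc.1 h).pos
      rw [h] at hst ha
      cases a <;> simp only [Allowed] at ha <;>
        simp only [next, State.column.injEq, reduceCtorEq] at hst
      omega

lemma eq_rise_digs_of_state {m p : ℕ} (hc : Valid c) (hst : state c = .row m p 1) :
    ∃ ds : List ℕ, c = .rise :: ds.map .dig := by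
  cases c with
  | nil => simp [state] at hst
  | cons a c =>
    have ha := hc.2
    rw [state] at hst
    cases h : state c with
    | column m' d' t' =>
      rw [h] at hst ha
      cases a <;> simp only [Allowed] at ha <;>
        simp only [next, State.row.injEq, reduceCtorEq] at hst
      obtain rfl : t' = 0 := by omega
      obtain ⟨ds, rfl⟩ := eq_digs_of_state hc.1 h
      exact ⟨ds, rfl⟩
    | row m' p' t' =>
      have hpos := (rowInv_word hc.1 h).pos
      rw [h] at hst ha
      cases a <;> simp only [Allowed] at ha <;>
        simp only [next, State.row.injEq, reduceCtorEq] at hst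
      omega

lemma snd_le_one_of_endpoint_north (h : IsThreeSided (u ++ [.east]))
    (he : endpoint u = (-1, 1)) : ∀ z ∈ visited u, z.2 ≤ 1 := by
  obtain ⟨hu, hs⟩ := isThreeSided_concat.1 h
  by_contra! ⟨z, hz, hlt⟩
  have := hs.east_extends hu hz (by simpa [he] using hlt) _ (zero_mem_visited u)
  simp [he] at this

lemma fst_nonpos_of_endpoint_north (h : IsThreeSided (u ++ [.east]))
    (he : endpoint u = (-1, 1)) : ∀ z ∈ visited u, z.1 ≤ 0 := by
  obtain ⟨hu, hs⟩ := isThreeSided_concat.1 h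
  by_contra! ⟨z, hz, hlt⟩
  obtain ⟨v, hvu, hv⟩ := exists_west_of_leaves hz hlt (by simp [he])
  have hadm := hu.admissible hvu
  have hpre := (List.prefix_append v _).trans hvu
  have hmem : endpoint v ∈ visited u := visited_mono hpre (endpoint_mem_visited v)
  have hle := snd_le_one_of_endpoint_north h he _ hmem
  have hzero := zero_mem_visited v
  have hne_one : (endpoint v).2 ≠ 1 := by
    intro h1
    have := hs.free _ hmem (by rw [h1, he])
    simp [hv, he] at this
  have hne_zero : (endpoint v).2 ≠ 0 := by
    intro h0
    refine hadm.notMem_visited ?_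
    convert hzero
    ext <;> simp [hv, h0, Dir.vec]
  have := hadm.west_extends (hu.of_prefix hpre) hzero (by simp only [Prod.snd_zero]; omega) _ hzero
  simp [hv] at this

lemma isBasic_of_endpoint_north (h : IsThreeSided (u ++ [.east]))
    (he : endpoint (u ++ [.east]) = (0, 1)) : IsBasic (u ++ [.east]) := by
  obtain ⟨hu, hs⟩ := isThreeSided_concat.1 h
  replace he : endpoint u = (-1, 1) := by
    rw [endpoint_append, endpoint_singleton] at he
    rw [← add_sub_cancel_right (endpoint u), he]
    rfl
  have hy := snd_le_one_of_endpoint_north h he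
  cases coded_of_isThreeSided hu (fst_nonpos_of_endpoint_north h he) with
  | column c m d d' t hc hst hword =>
    exfalso
    have hinv := columnInv_word hc hst
    have hend : endpoint u = (-(m : ℤ), (t : ℤ) - d') := hword ▸ hinv.endpoint_append_vert d'
    rw [he, Prod.mk.injEq] at hend
    obtain ⟨z, hz, hz1, hz2⟩ := hinv.top (by omega)
    replace hz : z ∈ visited u := visited_mono (hword ▸ List.prefix_append _ _) hz
    have hle := hy z hz
    have := hs.free z hz (by rw [he]; omega)
    rw [he] at this
    omega
  | row c m p p' t hc hst hp' hword =>
    have hend : endpoint u = (-(p' : ℤ), (t : ℤ)) :=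
      hword ▸ (rowInv_word hc hst).endpoint_append_horiz p'
    rw [he, Prod.mk.injEq] at hend
    obtain rfl : t = 1 := by omega
    obtain rfl : p' = 1 := by omega
    obtain ⟨ds, rfl⟩ := eq_rise_digs_of_state hc hst
    obtain ⟨rfl, rfl, -⟩ := State.row.inj ((state_rise_digs ds).symm.trans hst)
    refine .hanging ds (List.length_pos_iff.1 hp') ?_
    rw [hanging, hword, horiz_of_ge hp', List.append_assoc, ← List.replicate_succ',
      Nat.sub_add_cancel hp']

lemma endpoint_ne_south (h : IsThreeSided w) (hl : w.length ≠ 1) : endpoint w ≠ Dir.south.vec := by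
  intro he
  rcases List.eq_nil_or_concat' w with rfl | ⟨u, s, rfl⟩
  · simp [Dir.vec, Prod.ext_iff] at he
  have hne := polygon_last_ne h hl he
  obtain ⟨hu, hs⟩ := isThreeSided_concat.1 h
  rw [endpoint_append, endpoint_singleton] at he
  have he1 := congrArg Prod.fst he
  have he2 := congrArg Prod.snd he
  have hzero := zero_mem_visited u
  cases s <;> simp only [Dir.vec, Prod.fst_add, Prod.snd_add] at he1 he2
  · simp [Dir.vec] at hne
  · have := hs.east_extends hu hzero (by simp only [Prod.snd_zero]; omega) _ hzero
    simp only [Prod.fst_zero] at this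
    omega
  · simp at hne
  · have := hs.west_extends hu hzero (by simp only [Prod.snd_zero]; omega) _ hzero
    simp only [Prod.fst_zero] at this
    omega

lemma isBasic_or_mirror {n : ℕ} (h : w ∈ threeSidedPolygons n) : IsBasic w ∨ IsBasic w.mirror := by
  obtain ⟨⟨-, hl, d, hd⟩, h3, -⟩ := h
  rw [pos_length] at hd
  cases d with
  | east => exact Or.inl (isBasic_of_endpoint_east h3 hl hd)
  | west =>
    refine Or.inr (isBasic_of_endpoint_east h3.mirror (by rwa [length_mirror]) ?_)
    rw [endpoint_mirror, hd]
    rfl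
  | north =>
    rcases List.eq_nil_or_concat' w with rfl | ⟨u, s, rfl⟩
    · simp [Dir.vec, Prod.ext_iff] at hd
    have hne := polygon_last_ne h3 hl hd
    cases s with
    | north => simp at hne
    | south => simp [Dir.vec] at hne
    | east => exact Or.inl (isBasic_of_endpoint_north h3 hd)
    | west =>
      have hmirror := h3.mirror
      have hend := endpoint_mirror (u ++ [.west])
      rw [hd] at hend
      rw [mirror_concat] at hmirror hend ⊢
      exact Or.inr (isBasic_of_endpoint_north hmirror hend)
  | south => exact absurd hd (endpoint_ne_south h3 hl)

end Classification

section Counting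

/-! ### Counting codes -/

variable {α : Type*} {c : List Letter} {w p t a n : ℕ}

lemma encard_biUnion_finset {ι : Type*} (s : Finset ι) (S : ι → Set α) (g : ι → ℕ)
    (h : ∀ i ∈ s, (S i).encard = g i) (hd : (s : Set ι).PairwiseDisjoint S) :
    (⋃ i ∈ s, S i).encard = (∑ i ∈ s, g i : ℕ) := by
  rw [Nat.cast_sum, ← Finset.sum_congr rfl h, ← finsum_mem_coe_finset]
  exact s.finite_toSet.encard_biUnion hd

lemma disjoint_cons_image {x y : α} (h : x ≠ y) (S T : Set (List α)) :
    Disjoint ((x :: ·) '' S) ((y :: ·) '' T) := by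
  rw [Set.disjoint_left]
  rintro _ ⟨c, -, rfl⟩ ⟨c', -, e⟩
  exact h (List.cons.inj e).1.symm

lemma encard_cons_image (x : α) (S : Set (List α)) : ((x :: ·) '' S).encard = S.encard :=
  List.cons_injective.encard_image S

lemma encard_biUnion_cons_image (s : Finset ℕ) {f : ℕ → α} (hf : f.Injective)
    (S : ℕ → Set (List α)) (g : ℕ → ℕ) (h : ∀ i ∈ s, (S i).encard = g i) :
    (⋃ i ∈ s, (f i :: ·) '' S i).encard = (∑ i ∈ s, g i : ℕ) :=
  encard_biUnion_finset s _ g (fun i hi => by rw [encard_cons_image, h i hi])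
    fun _ _ _ _ hij => disjoint_cons_image (hf.ne hij) _ _

lemma encard_sep_const {S : Set α} {P : Prop} [Decidable P] (h : P → S.encard = n) :
    {c | c ∈ S ∧ P}.encard = (if P then n else 0 : ℕ) := by
  by_cases hP : P
  · simp [hP, h hP]
  · simp [hP]

/-- The codes of weight `a` that lead to a state `column w _ _`. -/
def columnCodes (w a : ℕ) : Set (List Letter) :=
  {c | Valid c ∧ (∃ d t, state c = .column w d t) ∧ weight c = a}

/-- The codes of weight `a` that lead to a state `row w _ _`. -/
def rowCodes (w a : ℕ) : Set (List Letter) :=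
  {c | Valid c ∧ (∃ p t, state c = .row w p t) ∧ weight c = a}

lemma columnCodes_zero_left (a : ℕ) : columnCodes 0 a = {c | c = [] ∧ a = 0} := by
  ext c
  constructor
  · rintro ⟨hc, ⟨d, t, hst⟩, rfl⟩
    cases c with
    | nil => exact ⟨rfl, rfl⟩
    | cons s c =>
      have hs := hc.2
      rw [state] at hst
      cases h : state c <;> rw [h] at hst hs <;> cases s <;> simp [next] at hst <;>
        simp [Allowed] at hs
  · rintro ⟨rfl, rfl⟩
    exact ⟨trivial, ⟨0, 0, rfl⟩, rfl⟩

lemma columnCodes_succ_left (w a : ℕ) : columnCodes (w + 1) a =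
    (.extend :: ·) '' rowCodes w a ∪
      ⋃ d ∈ Finset.range (a + 1), (.dig d :: ·) '' columnCodes w (a - d) := by
  ext c
  simp only [Set.mem_union, Set.mem_iUnion, Set.mem_image, Finset.mem_range]
  constructor
  · rintro ⟨hc, ⟨d, t, hst⟩, rfl⟩
    cases c with
    | nil => simp [state] at hst
    | cons s c =>
      have hs := hc.2
      rw [state] at hst
      rw [weight]
      cases h : state c <;> rw [h] at hst hs <;> cases s <;> simp only [Allowed] at hs <;>
        simp only [next, State.column.injEq, reduceCtorEq] at hst
      · obtain ⟨hw, rfl, rfl⟩ := hst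
        obtain rfl := Nat.add_right_cancel hw
        exact Or.inr ⟨_, by simp [letterWeight], c,
          ⟨hc.1, ⟨_, _, h⟩, by simp [letterWeight]⟩, rfl⟩
      · obtain ⟨hw, rfl, rfl⟩ := hst
        obtain rfl := Nat.add_right_cancel hw
        exact Or.inl ⟨c, ⟨hc.1, ⟨_, _, h⟩, by simp [letterWeight]⟩, rfl⟩
  · rintro (⟨c, ⟨hc, ⟨p, t, h⟩, rfl⟩, rfl⟩ | ⟨d, hd, c, ⟨hc, ⟨d', t, h⟩, e⟩, rfl⟩)
    · exact ⟨⟨hc, by rw [h]; trivial⟩, ⟨0, t, by rw [state, h]; rfl⟩, by rw [weight, h]; rfl⟩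
    · exact ⟨⟨hc, by rw [h]; trivial⟩, ⟨d, t, by rw [state, h]; rfl⟩, by
        rw [weight, h, e, letterWeight]; omega⟩

lemma rowCodes_eq (w a : ℕ) : rowCodes w a =
    (.rise :: ·) '' {c | c ∈ columnCodes w (a - (w + 1)) ∧ w + 1 ≤ a} ∪
      ⋃ p ∈ Finset.range (w + 1), (.shift p :: ·) ''
        {c | c ∈ rowCodes w (a - (p + 1)) ∧ p + 1 ≤ a} := by
  ext c
  simp only [Set.mem_union, Set.mem_iUnion, Set.mem_image, Finset.mem_range]
  constructor
  · rintro ⟨hc, ⟨p, t, hst⟩, rfl⟩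
    cases c with
    | nil => simp [state] at hst
    | cons s c =>
      have hs := hc.2
      rw [state] at hst
      rw [weight]
      cases h : state c <;> rw [h] at hst hs <;> cases s <;> simp only [Allowed] at hs <;>
        simp only [next, State.row.injEq, reduceCtorEq] at hst
      · obtain ⟨rfl, rfl, rfl⟩ := hst
        exact Or.inl ⟨c, ⟨⟨hc.1, ⟨_, _, h⟩, by simp [letterWeight]⟩, by simp [letterWeight]⟩, rfl⟩
      · obtain ⟨rfl, rfl, rfl⟩ := hst
        exact Or.inr ⟨_, by omega, c,
          ⟨⟨hc.1, ⟨_, _, h⟩, by simp [letterWeight]⟩, by simp [letterWeight]⟩, rfl⟩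
  · rintro (⟨c, ⟨⟨hc, ⟨d, t, h⟩, e⟩, hle⟩, rfl⟩ | ⟨p, hp, c, ⟨⟨hc, ⟨p', t, h⟩, e⟩, hle⟩, rfl⟩)
    · exact ⟨⟨hc, by rw [h]; trivial⟩, ⟨w, t + 1, by rw [state, h]; rfl⟩, by
        rw [weight, h, e, letterWeight]; omega⟩
    · exact ⟨⟨hc, by rw [h, Allowed]; omega⟩, ⟨p, t + 1, by rw [state, h]; rfl⟩, by
        rw [weight, h, e, letterWeight]; omega⟩

mutual

/-- The number of codes in `columnCodes w a`, computed by removing the last letter. -/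
def columnCount : ℕ → ℕ → ℕ
  | 0, a => if a = 0 then 1 else 0
  | w + 1, a => rowCount w a + ∑ d ∈ Finset.range (a + 1), columnCount w (a - d)
termination_by w a => 2 * w + a

/-- The number of codes in `rowCodes w a`, computed by removing the last letter. -/
def rowCount (w a : ℕ) : ℕ :=
  (if w + 1 ≤ a then columnCount w (a - (w + 1)) else 0) +
    ∑ p ∈ Finset.range (w + 1), if p + 1 ≤ a then rowCount w (a - (p + 1)) else 0
termination_by 2 * w + a + 1

end

mutual

lemma encard_columnCodes : ∀ w a : ℕ, (columnCodes w a).encard = columnCount w a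
  | 0, a => by
    rw [columnCodes_zero_left, columnCount]
    by_cases ha : a = 0 <;> simp [ha]
  | w + 1, a => by
    rw [columnCodes_succ_left, columnCount, Set.encard_union_eq, encard_cons_image,
      encard_rowCodes w a, encard_biUnion_cons_image _ (fun _ _ => Letter.dig.inj) _
        (fun d => columnCount w (a - d)) fun d _ => encard_columnCodes w (a - d), Nat.cast_add]
    rw [Set.disjoint_iUnion₂_right]
    exact fun d _ => disjoint_cons_image (by simp) _ _
termination_by w a => 2 * w + a

lemma encard_rowCodes (w a : ℕ) : (rowCodes w a).encard = rowCount w a := by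
  rw [rowCodes_eq, rowCount, Set.encard_union_eq, encard_cons_image,
    encard_sep_const fun _ => encard_columnCodes w (a - (w + 1)),
    encard_biUnion_cons_image _ (fun _ _ => Letter.shift.inj) _
      (fun p => if p + 1 ≤ a then rowCount w (a - (p + 1)) else 0)
      fun p _ => encard_sep_const fun _ => encard_rowCodes w (a - (p + 1)), Nat.cast_add]
  rw [Set.disjoint_iUnion₂_right]
  exact fun p _ => disjoint_cons_image (by simp) _ _
termination_by 2 * w + a + 1

end

lemma lt_weight (hc : Valid c) (hst : state c = .row w p t) : w < weight c := by
  induction c generalizing w p t with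
  | nil => simp [state] at hst
  | cons s c ih =>
    have hs := hc.2
    rw [state] at hst
    rw [weight]
    cases h : state c <;> rw [h] at hst hs <;> cases s <;> simp only [Allowed] at hs <;>
      simp only [next, State.row.injEq, reduceCtorEq] at hst
    · simp only [letterWeight]; omega
    · have := ih hc.1 h
      simp only [letterWeight]; omega

lemma rowCount_eq_zero (h : a ≤ w) : rowCount w a = 0 := by
  have : rowCodes w a = ∅ := Set.eq_empty_of_forall_notMem fun c ⟨hc, ⟨_, _, hst⟩, hw⟩ =>
    (hw ▸ lt_weight hc hst).not_ge h
  simpa [this] using (encard_rowCodes w a).symm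

/-- The codes of weight `a` that lead to a state `row _ _ _`. -/
def closableCodes (a : ℕ) : Set (List Letter) :=
  {c | Valid c ∧ (∃ w p t, state c = .row w p t) ∧ weight c = a}

lemma closableCodes_eq (a : ℕ) : closableCodes a = ⋃ w ∈ Finset.range a, rowCodes w a := by
  ext c
  simp only [Set.mem_iUnion, Finset.mem_range]
  constructor
  · rintro ⟨hc, ⟨w, p, t, hst⟩, hw⟩
    exact ⟨w, hw ▸ lt_weight hc hst, hc, ⟨p, t, hst⟩, hw⟩
  · rintro ⟨w, -, hc, ⟨p, t, hst⟩, hw⟩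
    exact ⟨hc, ⟨w, p, t, hst⟩, hw⟩

lemma encard_closableCodes (a : ℕ) :
    (closableCodes a).encard = (∑ w ∈ Finset.range a, rowCount w a : ℕ) := by
  rw [closableCodes_eq]
  refine encard_biUnion_finset _ _ _ (fun w _ => encard_rowCodes w a) fun w _ w' _ hww => ?_
  refine Set.disjoint_left.2 fun c ⟨_, ⟨p, t, h⟩, _⟩ ⟨_, ⟨p', t', h'⟩, _⟩ => hww ?_
  exact (State.row.inj (h.symm.trans h')).1

/-- The lists of dig depths with `∑ (d + 1) = n`: those for which `hanging` has area `n`. -/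
def digLists (n : ℕ) : Set (List ℕ) := {ds | ds.sum + ds.length = n}

lemma ne_nil_of_mem_digLists {ds : List ℕ} (h : ds ∈ digLists (n + 1)) : ds ≠ [] := by
  rintro rfl
  simp [digLists] at h

lemma map_succ_map_pred_blocks (c : Composition n) :
    (c.blocks.map Nat.pred).map Nat.succ = c.blocks := by
  rw [List.map_map]
  exact (List.map_congr_left fun k hk => Nat.succ_pred (c.blocks_pos hk).ne').trans
    (List.map_id _)

lemma digLists_eq_range (n : ℕ) :
    digLists n = Set.range fun c : Composition n => c.blocks.map Nat.pred := by
  have sum_map_succ (ds : List ℕ) : (ds.map Nat.succ).sum = ds.sum + ds.length := by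
    induction ds with
    | nil => rfl
    | cons d ds ih => simp only [List.map_cons, List.sum_cons, List.length_cons, ih]; omega
  ext ds
  constructor
  · intro h
    refine ⟨⟨ds.map Nat.succ, fun hk => ?_, (sum_map_succ ds).trans h⟩, ?_⟩
    · obtain ⟨d, -, rfl⟩ := List.mem_map.1 hk
      exact d.succ_pos
    · simp [Function.comp_def]
  · rintro ⟨c, rfl⟩
    rw [digLists, Set.mem_ofPred_eq, ← sum_map_succ, map_succ_map_pred_blocks, c.blocks_sum]

lemma encard_digLists_succ (n : ℕ) : (digLists (n + 1)).encard = (2 ^ n : ℕ) := by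
  have h_inj : Function.Injective fun c : Composition (n + 1) => c.blocks.map Nat.pred := by
    intro c c' h
    apply Composition.ext
    rw [← map_succ_map_pred_blocks c, ← map_succ_map_pred_blocks c']
    exact congrArg (List.map Nat.succ) h
  rw [digLists_eq_range, ← Set.image_univ, h_inj.encard_image, Set.encard_univ,
    ENat.card_eq_coe_fintype_card, composition_card, Nat.add_sub_cancel]

/-! ### Counting polygons -/

lemma exists_word_eq_concat (hc : Valid c) (hst : state c = .row w p t) :
    ∃ v, word c = v ++ [.north] := by
  cases c with
  | nil => simp [state] at hst
  | cons s c =>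
    have hs := hc.2
    rw [state] at hst
    rw [word]
    cases h : state c <;> rw [h] at hst hs <;> cases s <;> simp only [Allowed] at hs <;>
      simp only [next, State.row.injEq, reduceCtorEq] at hst
    · rename_i d _
      exact ⟨word c ++ List.replicate d .north, by
        rw [block, vert_of_ge (Nat.zero_le _), Nat.sub_zero, List.replicate_succ',
          List.append_assoc]⟩
    · exact ⟨_, (List.append_assoc _ _ _).symm⟩

lemma append_replicate_inj {v v' : List α} {k k' : ℕ} {x y : α} (h : y ≠ x)
    (e : v ++ [y] ++ List.replicate k x = v' ++ [y] ++ List.replicate k' x) : v = v' := by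
  have e' := congrArg List.reverse e
  simp only [List.reverse_append, List.reverse_replicate, List.reverse_singleton,
    List.singleton_append] at e'
  have y_notMem (k : ℕ) : y ∉ List.replicate k x := fun hy => h (List.eq_of_mem_replicate hy)
  exact List.reverse_injective (append_cons_inj (y_notMem k) (y_notMem k') e').2

lemma closing_injOn (a : ℕ) : Set.InjOn closing (closableCodes a) := by
  rintro c ⟨hc, ⟨w, p, t, hst⟩, -⟩ c' ⟨hc', ⟨w', p', t', hst'⟩, -⟩ e
  obtain ⟨v, hv⟩ := exists_word_eq_concat hc hst
  obtain ⟨v', hv'⟩ := exists_word_eq_concat hc' hst'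
  rw [closing_eq hst, closing_eq hst', List.replicate_succ', List.replicate_succ',
    ← List.append_assoc, ← List.append_assoc] at e
  have he := append_replicate_inj (by simp) e
  rw [hv, hv'] at he
  exact word_injOn hc hc' (by rw [hv, hv', append_replicate_inj (by simp) he])

lemma hanging_injective : Function.Injective hanging := by
  intro ds ds' e
  obtain ⟨v, hv⟩ := exists_word_eq_concat (valid_rise_digs ds) (state_rise_digs ds)
  obtain ⟨v', hv'⟩ := exists_word_eq_concat (valid_rise_digs ds') (state_rise_digs ds')
  rw [hanging, hanging, hv, hv'] at e
  have hcodes : Letter.rise :: ds.map .dig = .rise :: ds'.map .dig :=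
    word_injOn (valid_rise_digs ds) (valid_rise_digs ds')
      (by rw [hv, hv', append_replicate_inj (by simp) e])
  exact List.map_injective_iff.2 (fun _ _ => Letter.dig.inj) (List.cons.inj hcodes).2

/-- The polygons of area `n` in the standard orientation, one from each pair of mirror images. -/
def basicPolygons (n : ℕ) : Set Walk := {w | IsBasic w ∧ w ∈ threeSidedPolygons n}

lemma area_unique {w : Walk} {m n : ℕ} (h : w ∈ threeSidedPolygons m)
    (h' : w ∈ threeSidedPolygons n) : m = n := h.2.2.symm.trans h'.2.2

lemma basicPolygons_succ (n : ℕ) : basicPolygons (n + 1) =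
    closing '' closableCodes (n + 1) ∪
      ({columnPolygon (n + 1)} ∪ hanging '' digLists (n + 1)) := by
  ext u
  constructor
  · rintro ⟨⟨c, hc, w, p, t, hst, rfl⟩ | ⟨m, hm, rfl⟩ | ⟨ds, hds, rfl⟩, hu⟩
    · exact Or.inl ⟨c, ⟨hc, ⟨w, p, t, hst⟩, area_unique (closing_mem hc hst) hu⟩, rfl⟩
    · exact Or.inr (Or.inl (congrArg columnPolygon (area_unique (columnPolygon_mem hm) hu)))
    · exact Or.inr (Or.inr ⟨ds, area_unique (hanging_mem hds) hu, rfl⟩)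
  · rintro (⟨c, ⟨hc, ⟨w, p, t, hst⟩, hw⟩, rfl⟩ | rfl | ⟨ds, hds, rfl⟩)
    · exact ⟨.closing c hc w p t hst rfl, hw ▸ closing_mem hc hst⟩
    · exact ⟨.column _ n.succ_pos rfl, columnPolygon_mem n.succ_pos⟩
    · exact ⟨.hanging ds (ne_nil_of_mem_digLists hds) rfl,
        hds ▸ hanging_mem (ne_nil_of_mem_digLists hds)⟩

lemma getLast?_closing (hc : Valid c) (hst : state c = .row w p t) :
    (closing c).getLast? = some .south := by
  have := (rowInv_word hc hst).pos
  rw [closing_eq hst, List.getLast?_append, List.getLast?_replicate, if_neg (by omega)]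
  rfl

lemma getLast?_columnPolygon (hn : 1 ≤ n) : (columnPolygon n).getLast? = some .north := by
  rw [columnPolygon, List.getLast?_append, List.getLast?_replicate, if_neg (by omega)]
  rfl

lemma getLast?_hanging {ds : List ℕ} (h : ds ≠ []) : (hanging ds).getLast? = some .east := by
  simp [hanging, List.getLast?_append, List.getLast?_replicate, h]

lemma encard_basicPolygons_succ (n : ℕ) : (basicPolygons (n + 1)).encard =
    (∑ w ∈ Finset.range (n + 1), rowCount w (n + 1) + (1 + 2 ^ n) : ℕ) := by
  have column_ne_hanging : Disjoint {columnPolygon (n + 1)} (hanging '' digLists (n + 1)) := by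
    rw [Set.disjoint_singleton_left]
    rintro ⟨ds, hds, e⟩
    have := getLast?_hanging (ne_nil_of_mem_digLists hds)
    rw [e, getLast?_columnPolygon n.succ_pos] at this
    simp at this
  have closing_ne : Disjoint (closing '' closableCodes (n + 1))
      ({columnPolygon (n + 1)} ∪ hanging '' digLists (n + 1)) := by
    rw [Set.disjoint_left]
    rintro _ ⟨c, ⟨hc, ⟨w, p, t, hst⟩, -⟩, rfl⟩ h
    have := getLast?_closing hc hst
    rcases h with h | ⟨ds, hds, e⟩
    · rw [h, getLast?_columnPolygon n.succ_pos] at this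
      simp at this
    · rw [← e, getLast?_hanging (ne_nil_of_mem_digLists hds)] at this
      simp at this
  rw [basicPolygons_succ, Set.encard_union_eq closing_ne, Set.encard_union_eq column_ne_hanging,
    (closing_injOn _).encard_image, hanging_injective.encard_image, encard_closableCodes,
    Set.encard_singleton, encard_digLists_succ]
  push_cast
  rfl

lemma basicPolygons_zero : basicPolygons 0 = ∅ := by
  refine Set.eq_empty_of_forall_notMem ?_
  rintro _ ⟨⟨c, hc, w, p, t, hst, rfl⟩ | ⟨m, hm, rfl⟩ | ⟨ds, hds, rfl⟩, hu⟩
  · have := lt_weight hc hst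
    have := area_unique (closing_mem hc hst) hu
    omega
  · have := area_unique (columnPolygon_mem hm) hu
    omega
  · have := area_unique (hanging_mem hds) hu
    have := List.length_pos_iff.2 hds
    omega

lemma IsBasic.endpoint_or {w : Walk} (h : IsBasic w) :
    endpoint w = (1, 0) ∨ endpoint w = (0, 1) ∧ w.getLast? = some .east := by
  rcases h with ⟨c, hc, m, p, t, hst, rfl⟩ | ⟨m, -, rfl⟩ | ⟨ds, hds, rfl⟩
  · exact Or.inl (endpoint_closing hc hst)
  · exact Or.inl (endpoint_columnPolygon m)
  · exact Or.inr ⟨endpoint_hanging ds, getLast?_hanging hds⟩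

lemma IsBasic.not_mirror {w : Walk} (h : IsBasic w) : ¬ IsBasic w.mirror := by
  intro h'
  have e := endpoint_mirror w
  rcases h.endpoint_or with hw | ⟨hw, hlast⟩ <;>
    rcases h'.endpoint_or with hw' | ⟨hw', hlast'⟩ <;>
    rw [hw, hw'] at e <;> simp at e
  simp [mirror, hlast, Dir.mirror] at hlast'

lemma threeSidedPolygons_eq (n : ℕ) :
    threeSidedPolygons n = basicPolygons n ∪ mirror '' basicPolygons n := by
  ext w
  constructor
  · intro h
    rcases isBasic_or_mirror h with hb | hb
    · exact Or.inl ⟨hb, h⟩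
    · exact Or.inr ⟨w.mirror, ⟨hb, mirror_mem h⟩, mirror_mirror w⟩
  · rintro (h | ⟨u, h, rfl⟩)
    · exact h.2
    · exact mirror_mem h.2

lemma encard_threeSidedPolygons (n : ℕ) :
    (threeSidedPolygons n).encard = 2 * (basicPolygons n).encard := by
  rw [threeSidedPolygons_eq, Set.encard_union_eq, mirror_injective.encard_image, two_mul]
  rw [Set.disjoint_left]
  rintro _ h ⟨u, h', rfl⟩
  exact h'.1.not_mirror h.1

lemma threeSidedPolygons_zero : threeSidedPolygons 0 = ∅ := by
  simp [threeSidedPolygons_eq, basicPolygons_zero]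

lemma encard_threeSidedPolygons_succ (n : ℕ) : (threeSidedPolygons (n + 1)).encard =
    (2 * (∑ w ∈ Finset.range (n + 1), rowCount w (n + 1) + (1 + 2 ^ n)) : ℕ) := by
  rw [encard_threeSidedPolygons, encard_basicPolygons_succ, Nat.cast_mul, Nat.cast_ofNat]

theorem finite_threeSidedPolygons (n : ℕ) : (threeSidedPolygons n).Finite := by
  cases n with
  | zero => simp [threeSidedPolygons_zero]
  | succ n => exact Set.finite_of_encard_eq_coe (encard_threeSidedPolygons_succ n)

theorem ncard_threeSidedPolygons_succ (n : ℕ) : (threeSidedPolygons (n + 1)).ncard =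
    2 * (∑ w ∈ Finset.range (n + 1), rowCount w (n + 1) + (1 + 2 ^ n)) := by
  rw [Set.ncard, encard_threeSidedPolygons_succ, ENat.toNat_natCast]

lemma ncard_threeSidedPolygons_values (hn : n < 11) : (threeSidedPolygons n).ncard =
    [0, 6, 10, 20, 42, 92, 204, 454, 1010, 2242, 4962].getD n 0 := by
  cases n with
  | zero => simp [threeSidedPolygons_zero]
  | succ n =>
    rw [ncard_threeSidedPolygons_succ]
    have values : ∀ n < 10, 2 * (∑ w ∈ Finset.range (n + 1), rowCount w (n + 1) + (1 + 2 ^ n)) =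
        [0, 6, 10, 20, 42, 92, 204, 454, 1010, 2242, 4962].getD (n + 1) 0 := by
      decide +kernel
    exact values n (by omega)

end Counting

open PowerSeries
open scoped PowerSeries.WithPiTopology

/-! ### Formal power series -/

section Sums

variable {R : Type*} [CommRing R] {f : ℕ → PowerSeries R}

lemma eq_of_forall_X_pow_dvd_sub {f g : PowerSeries R} (h : ∀ N : ℕ, X ^ N ∣ f - g) : f = g := by
  ext n
  have := X_pow_dvd_iff.1 (h (n + 1)) n n.lt_succ_self
  rwa [map_sub, sub_eq_zero] at this

lemma finite_coeff_ne_zero (h : ∀ m, X ^ m ∣ f m) (n : ℕ) : {m | coeff n (f m) ≠ 0}.Finite :=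
  (Set.finite_Iic n).subset fun m hm => le_of_not_gt fun hn => hm (X_pow_dvd_iff.1 (h m) n hn)

variable [TopologicalSpace R]

lemma hasSum_of_X_pow_dvd (h : ∀ m, X ^ m ∣ f m) :
    HasSum f (PowerSeries.mk fun n => ∑ m ∈ Finset.range (n + 1), coeff n (f m)) := by
  rw [PowerSeries.WithPiTopology.hasSum_iff_hasSum_coeff]
  intro n
  rw [coeff_mk]
  refine hasSum_sum_of_ne_finset_zero fun m hm => X_pow_dvd_iff.1 (h m) n ?_
  rw [Finset.mem_range] at hm
  omega

variable [T2Space R]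

lemma coeff_tsum_of_X_pow_dvd (h : ∀ m, X ^ m ∣ f m) (n : ℕ) :
    coeff n (∑' m, f m) = ∑ m ∈ Finset.range (n + 1), coeff n (f m) := by
  rw [(hasSum_of_X_pow_dvd h).tsum_eq, coeff_mk]

lemma X_pow_dvd_tsum_sub_sum (h : ∀ m, X ^ m ∣ f m) (N : ℕ) :
    X ^ N ∣ ∑' m, f m - ∑ m ∈ Finset.range N, f m := by
  rw [X_pow_dvd_iff]
  intro n hn
  rw [map_sub, coeff_tsum_of_X_pow_dvd h, map_sum, sub_eq_zero]
  refine Finset.sum_subset (Finset.range_subset_range.2 hn) fun m _ hm => ?_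
  rw [Finset.mem_range] at hm
  exact X_pow_dvd_iff.1 (h m) n (by omega)

end Sums

section Inverses

variable {k : Type*} [Field k]

lemma inv_mul_self_of_constantCoeff {f : PowerSeries k} (h : constantCoeff f = 1) :
    f⁻¹ * f = 1 := PowerSeries.inv_mul_cancel f (by rw [h]; exact one_ne_zero)

lemma pow_inv_eq_inv_pow (f : PowerSeries k) (m : ℕ) : (f ^ m)⁻¹ = f⁻¹ ^ m := by
  induction m with
  | zero => simp
  | succ m ih => rw [pow_succ, PowerSeries.mul_inv_rev, ih, pow_succ']

lemma one_sub_two_mul_X_inv_mul : (1 - 2 * X : PowerSeries k)⁻¹ * (1 - 2 * X) = 1 :=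
  inv_mul_self_of_constantCoeff (by simp)

lemma one_sub_X_inv_mul : (1 - X : PowerSeries k)⁻¹ * (1 - X) = 1 :=
  inv_mul_self_of_constantCoeff (by simp)

lemma one_sub_X_sub_X_pow_inv_mul (m : ℕ) :
    (1 - X - X ^ (m + 1) : PowerSeries k)⁻¹ * (1 - X - X ^ (m + 1)) = 1 :=
  inv_mul_self_of_constantCoeff (by simp)

lemma mk_one_eq_inv : (PowerSeries.mk 1 : PowerSeries k) = (1 - X)⁻¹ :=
  (eq_inv_iff_mul_eq_one (by simp)).2 (PowerSeries.mk_one_mul_one_sub_eq_one k)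

lemma mk_two_pow_eq_inv : (PowerSeries.mk fun n => (2 : k) ^ n) = (1 - 2 * X)⁻¹ := by
  refine (eq_inv_iff_mul_eq_one (by simp)).2 ?_
  have := congrArg (rescale (2 : k)) (PowerSeries.mk_one_mul_one_sub_eq_one k)
  simpa [rescale_mk, rescale_X, ← map_ofNat (C (R := k)) 2] using this

end Inverses

/-! ### The functional equation -/

/-- The generating function of `columnCodes w`. -/
noncomputable def columnSeries (w : ℕ) : PowerSeries ℚ :=
  PowerSeries.mk fun a => (columnCount w a : ℚ)

/-- The generating function of `rowCodes w`. -/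
noncomputable def rowSeries (w : ℕ) : PowerSeries ℚ :=
  PowerSeries.mk fun a => (rowCount w a : ℚ)

lemma columnSeries_zero : columnSeries 0 = 1 := by
  ext a
  rw [columnSeries, coeff_mk, columnCount, coeff_one]
  split_ifs <;> simp

lemma columnSeries_succ (w : ℕ) :
    (1 - X) * columnSeries (w + 1) = (1 - X) * rowSeries w + columnSeries w := by
  have last_letter : columnSeries (w + 1) = rowSeries w + PowerSeries.mk 1 * columnSeries w := by
    ext a
    rw [map_add, coeff_mul, Finset.Nat.sum_antidiagonal_eq_sum_range_succ_mk]
    simp [columnSeries, rowSeries, columnCount]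
  rw [last_letter]
  linear_combination columnSeries w * PowerSeries.mk_one_mul_one_sub_eq_one ℚ

lemma rowSeries_eq (w : ℕ) : (1 - 2 * X + X ^ (w + 2)) * rowSeries w =
    (1 - X) * X ^ (w + 1) * columnSeries w := by
  have last_letter : rowSeries w = X ^ (w + 1) * columnSeries w +
      (∑ p ∈ Finset.range (w + 1), X ^ (p + 1)) * rowSeries w := by
    ext a
    rw [Finset.sum_mul, map_add, map_sum, rowSeries, coeff_mk, rowCount]
    simp only [coeff_X_pow_mul', columnSeries, coeff_mk]
    push_cast
    rfl
  have geom_sum : (∑ p ∈ Finset.range (w + 1), (X : PowerSeries ℚ) ^ (p + 1)) * (1 - X) =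
      X - X ^ (w + 2) := by
    simp only [pow_succ _ (_ : ℕ), ← Finset.sum_mul]
    linear_combination X * geom_sum_mul_neg (X : PowerSeries ℚ) (w + 1)
  linear_combination (1 - X) * last_letter + rowSeries w * geom_sum

lemma X_pow_dvd_rowSeries (w : ℕ) : X ^ (w + 1) ∣ rowSeries w := by
  rw [X_pow_dvd_iff]
  intro a ha
  rw [rowSeries, coeff_mk, rowCount_eq_zero (Nat.le_of_lt_succ ha), Nat.cast_zero]

/-- The bivariate generating function `∑ w, u ^ w * rowSeries w` at `u = X ^ m`. -/
noncomputable def widthSeries (m : ℕ) : PowerSeries ℚ := ∑' w : ℕ, X ^ (m * w) * rowSeries w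

lemma X_pow_dvd_X_pow_mul_rowSeries (m w : ℕ) : X ^ w ∣ X ^ (m * w) * rowSeries w :=
  ((pow_dvd_pow X w.le_succ).trans (X_pow_dvd_rowSeries w)).mul_left _

lemma sum_rowSeries (m N : ℕ) :
    (1 - 2 * X) * ∑ w ∈ Finset.range N, X ^ (m * w) * rowSeries w +
      X ^ 2 * ∑ w ∈ Finset.range N, X ^ ((m + 1) * w) * rowSeries w =
    (1 - X) * X * ∑ w ∈ Finset.range N, X ^ ((m + 1) * w) * columnSeries w := by
  simp only [Finset.mul_sum, ← Finset.sum_add_distrib]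
  refine Finset.sum_congr rfl fun w _ => ?_
  linear_combination X ^ (m * w) * rowSeries_eq w

lemma sum_columnSeries (k N : ℕ) :
    (1 - X - X ^ k) * ∑ w ∈ Finset.range N, X ^ (k * w) * columnSeries w =
    (1 - X) * (1 + X ^ k * ∑ w ∈ Finset.range N, X ^ (k * w) * rowSeries w) -
      (1 - X) * X ^ (k * N) * columnSeries N := by
  induction N with
  | zero => simp [columnSeries_zero]
  | succ N ih =>
    rw [Finset.sum_range_succ, Finset.sum_range_succ]
    linear_combination ih + X ^ (k * (N + 1)) * columnSeries_succ N

-- Eliminate `∑ X ^ ((m + 1) * w) * columnSeries w` between `sum_rowSeries` and `sum_columnSeries`.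
lemma widthSeries_functional_equation (m : ℕ) :
    (1 - 2 * X) * (1 - X - X ^ (m + 1)) * widthSeries m = X * (1 - X) ^ 2 -
      X ^ 2 * (1 - X - X ^ m + X ^ (m + 1) - X ^ (m + 2)) * widthSeries (m + 1) := by
  refine eq_of_forall_X_pow_dvd_sub fun N => ?_
  obtain ⟨a, ha⟩ := X_pow_dvd_tsum_sub_sum (X_pow_dvd_X_pow_mul_rowSeries m) N
  obtain ⟨b, hb⟩ := X_pow_dvd_tsum_sub_sum (X_pow_dvd_X_pow_mul_rowSeries (m + 1)) N
  rw [← widthSeries] at ha hb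
  refine ⟨(1 - 2 * X) * (1 - X - X ^ (m + 1)) * a +
    X ^ 2 * (1 - X - X ^ m + X ^ (m + 1) - X ^ (m + 2)) * b -
      (1 - X) ^ 2 * X * X ^ (m * N) * columnSeries N, ?_⟩
  linear_combination (1 - 2 * X) * (1 - X - X ^ (m + 1)) * ha +
    X ^ 2 * (1 - X - X ^ m + X ^ (m + 1) - X ^ (m + 2)) * hb +
    (1 - X - X ^ (m + 1)) * sum_rowSeries m N + (1 - X) * X * sum_columnSeries (m + 1) N

/-! ### Iterating the functional equation -/

/-- The coefficient of `widthSeries (m + 1)` in the functional equation solved for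
`widthSeries m`. -/
noncomputable def stepFactor (m : ℕ) : PowerSeries ℚ :=
  -X ^ 2 * (1 - 2 * X)⁻¹ *
    ((1 - X - X ^ m + X ^ (m + 1) - X ^ (m + 2)) * (1 - X - X ^ (m + 1))⁻¹)

lemma widthSeries_eq_add_stepFactor_mul (m : ℕ) : widthSeries m =
    X * (1 - X) ^ 2 * (1 - 2 * X)⁻¹ * (1 - X - X ^ (m + 1))⁻¹ +
      stepFactor m * widthSeries (m + 1) := by
  have cancel := one_sub_two_mul_X_inv_mul (k := ℚ)
  have cancel_m := one_sub_X_sub_X_pow_inv_mul (k := ℚ) m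
  rw [stepFactor]
  set a := (1 - 2 * X : PowerSeries ℚ)⁻¹
  set b := (1 - X - X ^ (m + 1) : PowerSeries ℚ)⁻¹
  linear_combination a * b * widthSeries_functional_equation m -
    widthSeries m * (cancel + a * (1 - 2 * X) * cancel_m)

lemma one_sub_X_sub_X_pow_zero_succ : (1 - X - X ^ (0 + 1) : PowerSeries ℚ) = 1 - 2 * X := by ring

lemma stepFactor_zero : stepFactor 0 = X ^ 4 * (1 - 2 * X)⁻¹ ^ 2 := by
  rw [stepFactor, one_sub_X_sub_X_pow_zero_succ]
  ring

lemma prod_stepFactor_succ (m : ℕ) : ∏ k ∈ Finset.range (m + 1), stepFactor k =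
    X ^ 4 * (1 - 2 * X)⁻¹ ^ 2 * ((-1) ^ m * X ^ (2 * m) * (1 - 2 * X)⁻¹ ^ m *
      ∏ k ∈ Finset.Ico 1 (m + 1),
        (1 - X - X ^ k + X ^ (k + 1) - X ^ (k + 2)) * (1 - X - X ^ (k + 1))⁻¹) := by
  rw [Finset.range_eq_Ico, Finset.prod_eq_prod_Ico_succ_bot (Nat.succ_pos m), stepFactor_zero]
  congr 1
  simp only [stepFactor]
  rw [Finset.prod_mul_distrib, Finset.prod_const, Nat.card_Ico, Nat.zero_add,
    Nat.succ_sub_one, mul_pow, neg_pow, ← pow_mul]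

lemma summand_succ (m : ℕ) : summand (m + 1) =
    X ^ (2 * (m + 1)) * ((-1) ^ (m + 1) * (1 - 2 * X)⁻¹ ^ (m + 1) * (1 - X - X ^ (m + 2))⁻¹ *
    ∏ k ∈ Finset.Ico 1 (m + 1),
      (1 - X - X ^ k + X ^ (k + 1) - X ^ (k + 2)) * (1 - X - X ^ (k + 1))⁻¹) := by
  rw [summand, PowerSeries.mul_inv_rev, pow_inv_eq_inv_pow]
  ring

lemma X_pow_dvd_summand_succ (m : ℕ) : X ^ m ∣ summand (m + 1) := by
  rw [summand_succ]
  exact (pow_dvd_pow X (by omega)).mul_right _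

lemma widthSeries_zero_eq_sum_add (M : ℕ) : widthSeries 0 =
    X * (1 - X) ^ 2 * (1 - 2 * X)⁻¹ ^ 2 -
      X ^ 3 * (1 - X) ^ 2 * (1 - 2 * X)⁻¹ ^ 2 * ∑ m ∈ Finset.range M, summand (m + 1) +
      (∏ k ∈ Finset.range (M + 1), stepFactor k) * widthSeries (M + 1) := by
  induction M with
  | zero =>
    have first_step := widthSeries_eq_add_stepFactor_mul 0
    rw [one_sub_X_sub_X_pow_zero_succ] at first_step
    simp only [zero_add, Finset.range_zero, Finset.sum_empty, Finset.prod_range_one]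
    linear_combination first_step
  | succ M ih =>
    rw [ih, Finset.prod_range_succ _ (M + 1), Finset.sum_range_succ, summand_succ]
    linear_combination (∏ k ∈ Finset.range (M + 1), stepFactor k) *
        widthSeries_eq_add_stepFactor_mul (M + 1) +
      X * (1 - X) ^ 2 * (1 - 2 * X)⁻¹ * (1 - X - X ^ (M + 2))⁻¹ * prod_stepFactor_succ M

lemma X_pow_dvd_prod_stepFactor (M : ℕ) : X ^ M ∣ ∏ k ∈ Finset.range (M + 1), stepFactor k := by
  rw [prod_stepFactor_succ]
  exact .mul_left (.mul_right (.mul_right (.mul_left (pow_dvd_pow X (by omega)) _) _) _) _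

lemma widthSeries_zero_eq : widthSeries 0 =
    X * (1 - X) ^ 2 * (1 - 2 * X)⁻¹ ^ 2 -
      X ^ 3 * (1 - X) ^ 2 * (1 - 2 * X)⁻¹ ^ 2 * ∑' m : ℕ, summand (m + 1) := by
  refine eq_of_forall_X_pow_dvd_sub fun M => ?_
  obtain ⟨a, ha⟩ := X_pow_dvd_tsum_sub_sum X_pow_dvd_summand_succ M
  obtain ⟨b, hb⟩ := X_pow_dvd_prod_stepFactor M
  refine ⟨X ^ 3 * (1 - X) ^ 2 * (1 - 2 * X)⁻¹ ^ 2 * a + b * widthSeries (M + 1), ?_⟩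
  linear_combination widthSeries_zero_eq_sum_add M +
    X ^ 3 * (1 - X) ^ 2 * (1 - 2 * X)⁻¹ ^ 2 * ha + widthSeries (M + 1) * hb

lemma PA3_eq_widthSeries_zero : PA3 = 2 * (widthSeries 0 + X * ((1 - X)⁻¹ + (1 - 2 * X)⁻¹)) := by
  rw [← mk_one_eq_inv, ← mk_two_pow_eq_inv, ← map_ofNat (C (R := ℚ)) 2]
  ext n
  rw [PA3, coeff_mk, coeff_C_mul, map_add, widthSeries,
    coeff_tsum_of_X_pow_dvd (X_pow_dvd_X_pow_mul_rowSeries 0), Finset.sum_range_succ]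
  cases n with
  | zero => simp [threeSidedPolygons_zero, rowSeries, rowCount_eq_zero]
  | succ n =>
    rw [ncard_threeSidedPolygons_succ, coeff_succ_X_mul]
    simp [rowSeries, rowCount_eq_zero]

lemma PA3_eq_tsum_summand :
    PA3 = -2 * X ^ 3 * (1 - X) ^ 2 * ((1 - 2 * X) ^ 2)⁻¹ * (∑' m : ℕ, summand (m + 1)) +
      2 * X * (3 - 10 * X + 9 * X ^ 2 - X ^ 3) * ((1 - 2 * X) ^ 2 * (1 - X))⁻¹ := by
  have cancel_one_sub_two_mul_X := one_sub_two_mul_X_inv_mul (k := ℚ)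
  have cancel_one_sub_X := one_sub_X_inv_mul (k := ℚ)
  rw [PA3_eq_widthSeries_zero, widthSeries_zero_eq, PowerSeries.mul_inv_rev, pow_inv_eq_inv_pow]
  set a := (1 - 2 * X : PowerSeries ℚ)⁻¹
  set b := (1 - X : PowerSeries ℚ)⁻¹
  linear_combination
    (-2 * X * b * (a * (1 - 2 * X) + 1) - 2 * X * a) * cancel_one_sub_two_mul_X +
      (-2 * X * (1 - X) ^ 2 * a ^ 2 - 2 * X * a ^ 2 * (1 - 2 * X)) * cancel_one_sub_X

end Prudent

open Prudent PowerSeries in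
open scoped PowerSeries.WithPiTopology in
/-- The sets of polygons that are counted are finite, the series over `m ≥ 1` converges formally
(each power of `q` occurs in finitely many summands only), the area generating function is given
by the formula, and its expansion begins as listed. -/
theorem theorem2p3 :
    (∀ n, (threeSidedPolygons n).Finite) ∧
    (∀ d : ℕ, {m : ℕ | coeff d (summand (m + 1)) ≠ 0}.Finite) ∧
    Summable (fun m : ℕ => summand (m + 1)) ∧
    PA3 = -2 * X ^ 3 * (1 - X) ^ 2 * ((1 - 2 * X) ^ 2)⁻¹ * (∑' m : ℕ, summand (m + 1)) +
      2 * X * (3 - 10 * X + 9 * X ^ 2 - X ^ 3) * ((1 - 2 * X) ^ 2 * (1 - X))⁻¹ ∧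
    (∀ n < 11, coeff n PA3 =
      ([0, 6, 10, 20, 42, 92, 204, 454, 1010, 2242, 4962] : List ℚ).getD n 0) := by
  refine ⟨finite_threeSidedPolygons, finite_coeff_ne_zero X_pow_dvd_summand_succ,
    (hasSum_of_X_pow_dvd X_pow_dvd_summand_succ).summable, PA3_eq_tsum_summand, fun n hn => ?_⟩
  rw [PA3, coeff_mk, ncard_threeSidedPolygons_values hn]
  interval_cases n <;> simp
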